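/- Let $p$ be a positive integer and let $\lambda,\mu,\tau\in\mathbb{C}$ satisfy $|\lambda|\ge|\mu|>1$ and $(\lambda-\mu^p)\tau=0$. Put $G(z_1,z_2)=(\lambda z_1+\tau z_2^p,\ \mu z_2)$ on $\mathbb{C}^2$, and let $W=\mathbb{C}^2\setminus\{O\}$. Let $\varphi$ be a $C^\infty$ diffeomorphism of $[0,\infty)$ with $\varphi(x)>x$ for all $x>0$. Put $\tilde R=\mathbb{C}^2\times[0,\infty)\setminus\{(O,0)\}$ and $T=G\times\varphi:\tilde R\to\tilde R$. The 5-dimensional LC Reeb component is the quotient $R=\tilde R/\langle T\rangle$, with the smooth structure induced from $\tilde R$ and the foliation whose leaves are the images of $\mathbb{C}^2\times\{x\}$ ($x>0$) and of $W\times\{0\}$, with their induced complex structures. Its boundary leaf is the primary Hopf surface $H=W/\langle G\rangle$, embedded by $[z]\mapsto[(z,0)]$. Let $\mathrm{Aut}\,R$ be the group of diffeomorphisms of $R$ that preserve the foliation and restrict to biholomorphisms between leaves, and let $\mathrm{Aut}\,H$ be the group of biholomorphisms of $H$. **Proposition 3.3.** Every $f\in\mathrm{Aut}\,R$ maps $H$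 onto $H$ and restricts to an element of $\mathrm{Aut}\,H$, and the resulting restriction homomorphism $r_H:\mathrm{Aut}\,R\to\mathrm{Aut}\,H$ is surjective. More precisely, for every $h\in\mathrm{Aut}\,H$ there is a biholomorphism $F$ of $\mathbb{C}^2$ with $F(O)=O$ and $F\circ G=G\circ F$ whose restriction to $W$ is a lift of $h$, that is, $h([z])=[F(z)]$ for $z\in W$, and there is $f\in\mathrm{Aut}\,R$ with $f([(z,x)])=[(F(z),x)]$ for all $(z,x)\in\tilde R$ and $r_H(f)=h$. -/

import Mathlib

open scoped Manifold ContDiff NNReal Topology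

namespace LCReeb

/-! ### The orbit space of a homeomorphism, and its charts -/

/-- Two points are equivalent if one is the image of the other under an integer power of `T`. -/
def orbitSetoid {X : Type*} [TopologicalSpace X] (T : X ≃ₜ X) : Setoid X where
  r x y := ∃ n : ℤ, (T ^ n) x = y
  iseqv :=
    { refl := fun x => ⟨0, by simp⟩
      symm := by
        rintro x y ⟨n, rfl⟩
        exact ⟨-n, by rw [← Homeomorph.mul_apply, ← zpow_add]; simp⟩
      trans := by
        rintro x y z ⟨n, rfl⟩ ⟨m, rfl⟩
        exact ⟨m + n, by rw [zpow_add, Homeomorph.mul_apply]⟩ }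

/-- The quotient of `X` by the infinite cyclic group generated by `T`, with the quotient
topology. -/
abbrev OrbitSpace {X : Type*} [TopologicalSpace X] (T : X ≃ₜ X) : Type _ :=
  Quotient (orbitSetoid T)

/-- The canonical projection. -/
def proj {X : Type*} [TopologicalSpace X] (T : X ≃ₜ X) : X → OrbitSpace T :=
  Quotient.mk (orbitSetoid T)

theorem proj_eq_iff {X : Type*} [TopologicalSpace X] (T : X ≃ₜ X) {x y : X} :
    proj T x = proj T y ↔ ∃ n : ℤ, (T ^ n) x = y :=
  Quotient.eq (r := orbitSetoid T)

/-- If some continuous function strictly increases along `T`, then the projection to the orbit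
space is a local homeomorphism. -/
theorem proj_isLocalHomeomorph {X : Type*} [TopologicalSpace X] (T : X ≃ₜ X) (N : X → ℝ)
    (hN : Continuous N) (h : ∀ x, N x < N (T x)) : IsLocalHomeomorph (proj T) := by
  have hcont : Continuous (proj T) := continuous_quot_mk
  have hpow : ∀ (n : ℕ) x, N x ≤ N ((T ^ n) x) := by
    intro n
    induction n with
    | zero => intro x; simp
    | succ k ih =>
      intro x
      rw [pow_succ, Homeomorph.mul_apply]
      exact (h x).le.trans (ih (T x))
  have hopen : IsOpenMap (proj T) := by
    intro U hU
    have : proj T ⁻¹' (proj T '' U) = ⋃ n : ℤ, (T ^ n) ⁻¹' U := by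
      ext x
      simp only [Set.mem_preimage, Set.mem_image, Set.mem_iUnion]
      constructor
      · rintro ⟨y, hy, hyx⟩
        obtain ⟨n, hn⟩ := (proj_eq_iff T).1 hyx.symm
        exact ⟨n, hn ▸ hy⟩
      · rintro ⟨n, hn⟩
        exact ⟨_, hn, ((proj_eq_iff T).2 ⟨n, rfl⟩).symm⟩
    change IsOpen (proj T ⁻¹' (proj T '' U))
    rw [this]
    exact isOpen_iUnion fun n => hU.preimage (T ^ n).continuous
  rw [isLocalHomeomorph_iff_isOpenEmbedding_restrict]
  intro x
  obtain ⟨m, hm1, hm2⟩ := exists_between (h x)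
  have hU : IsOpen {y | N y < m ∧ m < N (T y)} :=
    (isOpen_lt hN continuous_const).inter
      (isOpen_lt continuous_const (hN.comp T.continuous))
  refine ⟨_, hU.mem_nhds ⟨hm1, hm2⟩, ?_⟩
  have key : ∀ y ∈ {y | N y < m ∧ m < N (T y)}, ∀ k : ℕ, (T ^ (k + 1)) y ∉
      {y | N y < m ∧ m < N (T y)} := by
    intro y hy k hk
    have := hpow k (T y)
    rw [pow_succ, Homeomorph.mul_apply] at hk
    linarith [hy.2, hk.1]
  refine Topology.IsOpenEmbedding.of_continuous_injective_isOpenMap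
    (hcont.comp continuous_subtype_val) ?_ (hopen.domRestrict hU)
  rintro ⟨y, hy⟩ ⟨z, hz⟩ hyz
  obtain ⟨n, hn⟩ := (proj_eq_iff T).1 hyz
  rcases n with n | n
  · rcases n with _ | k
    · simpa using hn
    · exfalso
      refine key y hy k ?_
      have : (T ^ (k + 1)) y = z := by simpa [← zpow_natCast] using hn
      rw [this]; exact hz
  · exfalso
    refine key z hz n ?_
    have : (T ^ (n + 1)) z = y := by
      replace hn : (T ^ Int.negSucc n) y = z := hn
      rw [← hn, zpow_negSucc, ← Homeomorph.mul_apply]; simp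
    rw [this]; exact hy

/-- The charts of the orbit space: a local inverse of the projection, followed by a chart
of `X`. -/
noncomputable abbrev orbitChartedSpace {X : Type*} [TopologicalSpace X] (M : Type*)
    [TopologicalSpace M] [ChartedSpace M X] (T : X ≃ₜ X) (hT : IsLocalHomeomorph (proj T)) :
    ChartedSpace M (OrbitSpace T) where
  atlas := {c | ∃ x : X, c = (hT.localInverseAt x).trans (chartAt M x)}
  chartAt y := (hT.localInverseAt (Quotient.out y)).trans (chartAt M (Quotient.out y))
  mem_chart_source y := by
    have hy : proj T (Quotient.out y) = y := Quotient.out_eq y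
    have h1 := hT.apply_self_mem_localInverseAt_source (x := Quotient.out y)
    have h2 := hT.localInverseAt_apply_self (x := Quotient.out y)
    rw [hy] at h1 h2
    simp [h1, h2]
  chart_mem_atlas y := ⟨_, rfl⟩

/-- If `T` and its inverse are of class `C^n`, then so are the coordinate changes of the
orbit space. -/
theorem orbitSpace_isManifold {𝕜 : Type*} [NontriviallyNormedField 𝕜] {E : Type*}
    [NormedAddCommGroup E] [NormedSpace 𝕜 E] {M : Type*} [TopologicalSpace M]
    (I : ModelWithCorners 𝕜 E M) (n : ℕ∞ω) {X : Type*} [TopologicalSpace X]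
    [ChartedSpace M X] [IsManifold I n X] (T : X ≃ₜ X) (hT : IsLocalHomeomorph (proj T))
    (h1 : ContMDiff I I n T) (h2 : ContMDiff I I n T.symm) :
    letI := orbitChartedSpace M T hT
    IsManifold I n (OrbitSpace T) := by
  let _ := orbitChartedSpace M T hT
  have hk : ∀ k : ℤ, ContMDiff I I n (T ^ k) := by
    have hnat : ∀ (S : X ≃ₜ X), ContMDiff I I n S → ∀ k : ℕ, ContMDiff I I n (S ^ k) := by
      intro S hS k
      induction k with
      | zero => exact contMDiff_id
      | succ k ih => rw [pow_succ]; exact ih.comp hS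
    intro k
    rcases k with k | k
    · simpa using hnat T h1 k
    · rw [zpow_negSucc, ← inv_pow]
      exact hnat T⁻¹ h2 (k + 1)
  refine isManifold_of_contDiffOn I n _ ?_
  rintro _ _ ⟨x, rfl⟩ ⟨y, rfl⟩
  set sx := hT.localInverseAt x with hsx
  set sy := hT.localInverseAt y with hsy
  have ex : ∀ a, sx.symm a = proj T a := fun a => congrFun (hT.localInverseAt_symm x) a
  have ey : ∀ a, sy.symm a = proj T a := fun a => congrFun (hT.localInverseAt_symm y) a
  intro u hu
  obtain ⟨hu, hur⟩ := hu
  set a := (chartAt M x).symm (I.symm u) with ha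
  have hu' : I.symm u ∈ (chartAt M x).target ∧ a ∈ sx.target ∧
      proj T a ∈ sy.source ∧ sy (proj T a) ∈ (chartAt M y).source := by
    simpa [ex, and_assoc] using hu
  obtain ⟨hu1, hu2, hu3, hu4⟩ := hu'
  obtain ⟨k, hkk⟩ : ∃ k : ℤ, (T ^ k) a = sy (proj T a) := by
    rw [← proj_eq_iff, ← ey (sy (proj T a)), sy.left_inv hu3]
  have hsmooth := (contMDiff_iff.1 (hk k)).2 x y
  have hcw : ContinuousWithinAt (fun v => (T ^ k) ((chartAt M x).symm (I.symm v)))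
      (I.symm ⁻¹' (((sx.trans (chartAt M x)).symm.trans (sy.trans (chartAt M y))).source) ∩
        Set.range I) u := by
    refine ContinuousAt.continuousWithinAt ?_
    exact (T ^ k).continuous.continuousAt.comp
      (((chartAt M x).continuousAt_symm hu1).comp I.continuous_symm.continuousAt)
  have hmem : (T ^ k) a ∈ sy.target := by rw [hkk]; exact sy.map_source hu3
  have hev := hcw.preimage_mem_nhdsWithin (sy.open_target.mem_nhds hmem)
  have heq : ∀ v, (T ^ k) ((chartAt M x).symm (I.symm v)) ∈ sy.target →
      sy (proj T ((chartAt M x).symm (I.symm v))) =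
        (T ^ k) ((chartAt M x).symm (I.symm v)) := by
    intro v hv
    rw [(proj_eq_iff T).2 ⟨k, rfl⟩, ← ey, sy.right_inv hv]
  have hau : u ∈ (extChartAt I x).target ∩
      (extChartAt I x).symm ⁻¹' ((T ^ k) ⁻¹' (extChartAt I y).source) := by
    refine ⟨by rw [extChartAt_target]; exact ⟨hu1, hur⟩, ?_⟩
    simp only [Set.mem_preimage, extChartAt_source, extChartAt_coe_symm, Function.comp_apply]
    rw [← ha, hkk]
    exact hu4
  refine ((hsmooth u hau).mono_of_mem_nhdsWithin ?_).congr_of_eventuallyEq ?_ ?_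
  · filter_upwards [hev, self_mem_nhdsWithin] with v hv hv2
    obtain ⟨hv2, hvr⟩ := hv2
    have hv' : I.symm v ∈ (chartAt M x).target ∧ (chartAt M x).symm (I.symm v) ∈ sx.target ∧
        proj T ((chartAt M x).symm (I.symm v)) ∈ sy.source ∧
        sy (proj T ((chartAt M x).symm (I.symm v))) ∈ (chartAt M y).source := by
      simpa [ex, and_assoc] using hv2
    refine ⟨by rw [extChartAt_target]; exact ⟨hv'.1, hvr⟩, ?_⟩
    simp only [Set.mem_preimage, extChartAt_source, extChartAt_coe_symm, Function.comp_apply]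
    rw [← heq v hv]
    exact hv'.2.2.2
  · filter_upwards [hev] with v hv
    simp [ex, heq v hv]
  · simp [ex, heq u hmem]

/-! ### Primary Hopf surfaces -/

/-- The constants of a normal form of a primary Hopf surface. -/
structure HopfData where
  p : ℕ
  lam : ℂ
  mu : ℂ
  tau : ℂ
  p_pos : 0 < p
  one_lt_mu : 1 < ‖mu‖
  mu_le_lam : ‖mu‖ ≤ ‖lam‖
  resonance : (lam - mu ^ p) * tau = 0

theorem HopfData.mu_ne_zero (D : HopfData) : D.mu ≠ 0 :=
  norm_pos_iff.1 (zero_lt_one.trans D.one_lt_mu)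

theorem HopfData.lam_ne_zero (D : HopfData) : D.lam ≠ 0 :=
  norm_pos_iff.1 (zero_lt_one.trans (D.one_lt_mu.trans_le D.mu_le_lam))

/-- The automorphism `G (z₁, z₂) = (λ z₁ + τ z₂ ^ p, μ z₂)` of `ℂ²`. -/
noncomputable def HopfData.G (D : HopfData) : (ℂ × ℂ) ≃ₜ (ℂ × ℂ) where
  toFun z := (D.lam * z.1 + D.tau * z.2 ^ D.p, D.mu * z.2)
  invFun w := ((w.1 - D.tau * (w.2 / D.mu) ^ D.p) / D.lam, w.2 / D.mu)
  left_inv z := by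
    have := D.mu_ne_zero
    have := D.lam_ne_zero
    ext <;> simp <;> field_simp
    ring
  right_inv w := by
    have := D.mu_ne_zero
    have := D.lam_ne_zero
    ext <;> simp <;> field_simp
    ring
  continuous_toFun := by fun_prop
  continuous_invFun := by
    have := D.mu_ne_zero
    have := D.lam_ne_zero
    fun_prop

theorem HopfData.G_zero (D : HopfData) : D.G 0 = 0 := by
  have := D.p_pos.ne'
  simp [HopfData.G, this]

/-- A function on `ℂ²` that increases along `G`. -/
noncomputable def HopfData.height (D : HopfData) (z : ℂ × ℂ) : ℝ :=
  ‖z.1‖ + (‖D.tau‖ + 1) / (‖D.mu‖ ^ D.p - 1) * ‖z.2‖ ^ D.p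

theorem HopfData.continuous_height (D : HopfData) : Continuous D.height := by
  unfold HopfData.height
  fun_prop

theorem HopfData.height_add_le (D : HopfData) (z : ℂ × ℂ) :
    D.height z + ((‖D.lam‖ - 1) * ‖z.1‖ + ‖z.2‖ ^ D.p) ≤ D.height (D.G z) := by
  have hc : 0 < ‖D.mu‖ ^ D.p - 1 := sub_pos.2 (one_lt_pow₀ D.one_lt_mu D.p_pos.ne')
  have h1 : ‖D.lam‖ * ‖z.1‖ - ‖D.tau‖ * ‖z.2‖ ^ D.p ≤ ‖D.lam * z.1 + D.tau * z.2 ^ D.p‖ := by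
    have := norm_sub_le (D.lam * z.1 + D.tau * z.2 ^ D.p) (D.tau * z.2 ^ D.p)
    simp only [add_sub_cancel_right, norm_mul, norm_pow] at this
    linarith
  have h2 : (‖D.tau‖ + 1) / (‖D.mu‖ ^ D.p - 1) * (‖D.mu‖ * ‖z.2‖) ^ D.p =
      (‖D.tau‖ + 1) / (‖D.mu‖ ^ D.p - 1) * ‖z.2‖ ^ D.p + (‖D.tau‖ + 1) * ‖z.2‖ ^ D.p := by
    rw [mul_pow]
    field_simp
    ring
  simp only [HopfData.height, HopfData.G, Homeomorph.homeomorph_mk_coe, Equiv.coe_fn_mk,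
    norm_mul]
  rw [h2]
  nlinarith

theorem HopfData.height_le (D : HopfData) (z : ℂ × ℂ) : D.height z ≤ D.height (D.G z) := by
  have := D.height_add_le z
  have h1 : 0 ≤ (‖D.lam‖ - 1) * ‖z.1‖ :=
    mul_nonneg (sub_nonneg.2 (D.one_lt_mu.le.trans D.mu_le_lam)) (norm_nonneg _)
  have h2 : 0 ≤ ‖z.2‖ ^ D.p := by positivity
  linarith

theorem HopfData.height_lt (D : HopfData) {z : ℂ × ℂ} (hz : z ≠ 0) :
    D.height z < D.height (D.G z) := by
  refine lt_of_lt_of_le ?_ (D.height_add_le z)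
  have hl : 0 < ‖D.lam‖ - 1 := sub_pos.2 (D.one_lt_mu.trans_le D.mu_le_lam)
  have h1 : 0 ≤ (‖D.lam‖ - 1) * ‖z.1‖ := mul_nonneg hl.le (norm_nonneg _)
  have h2 : 0 ≤ ‖z.2‖ ^ D.p := by positivity
  by_cases h : z.1 = 0
  · have : z.2 ≠ 0 := fun h' => hz (Prod.ext h h')
    have : 0 < ‖z.2‖ ^ D.p := by positivity
    linarith
  · have : 0 < (‖D.lam‖ - 1) * ‖z.1‖ := mul_pos hl (norm_pos_iff.2 h)
    linarith

/-- The domain `W = ℂ² ∖ {0}`. -/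
def W : TopologicalSpace.Opens (ℂ × ℂ) := ⟨{z | z ≠ 0}, isOpen_ne⟩

/-- The restriction of `G` to `W`. -/
noncomputable def HopfData.GW (D : HopfData) : W ≃ₜ W :=
  D.G.subtype fun z => by
    change z ≠ 0 ↔ D.G z ≠ 0
    rw [not_iff_not]
    constructor
    · rintro rfl; exact D.G_zero
    · intro h; exact D.G.injective (h.trans D.G_zero.symm)

/-- The primary Hopf surface `H = W / ⟨G⟩`. -/
def HopfSurface (D : HopfData) : Type := OrbitSpace D.GW

noncomputable instance (D : HopfData) : TopologicalSpace (HopfSurface D) :=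
  inferInstanceAs (TopologicalSpace (OrbitSpace D.GW))

/-- The covering map `W → H`. -/
noncomputable def HopfData.projH (D : HopfData) : W → HopfSurface D := proj D.GW

theorem HopfData.projH_isLocalHomeomorph (D : HopfData) : IsLocalHomeomorph (proj D.GW) :=
  proj_isLocalHomeomorph D.GW (fun z => D.height z.1)
    (D.continuous_height.comp continuous_subtype_val) fun z => D.height_lt z.2

/-- The charts of `H` are the local inverses of the covering map `W → H`. -/
noncomputable instance (D : HopfData) : ChartedSpace (ℂ × ℂ) (HopfSurface D) :=
  orbitChartedSpace (ℂ × ℂ) D.GW D.projH_isLocalHomeomorph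

/-- `H` is a complex manifold. -/
instance (D : HopfData) : IsManifold 𝓘(ℂ, ℂ × ℂ) ∞ (HopfSurface D) := by
  refine orbitSpace_isManifold 𝓘(ℂ, ℂ × ℂ) ∞ D.GW D.projH_isLocalHomeomorph ?_ ?_
  · rw [← ContMDiff.subtypeVal_comp_iff]
    have : ContMDiff 𝓘(ℂ, ℂ × ℂ) 𝓘(ℂ, ℂ × ℂ) ∞
        (fun z : ℂ × ℂ => (D.lam * z.1 + D.tau * z.2 ^ D.p, D.mu * z.2)) := by
      rw [contMDiff_iff_contDiff]; fun_prop
    exact this.comp contMDiff_subtype_val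
  · rw [← ContMDiff.subtypeVal_comp_iff]
    have : ContMDiff 𝓘(ℂ, ℂ × ℂ) 𝓘(ℂ, ℂ × ℂ) ∞ (fun w : ℂ × ℂ =>
        ((w.1 - D.tau * (w.2 / D.mu) ^ D.p) / D.lam, w.2 / D.mu)) := by
      rw [contMDiff_iff_contDiff]
      simp only [div_eq_mul_inv]
      fun_prop
    exact this.comp contMDiff_subtype_val

/-- The group of holomorphic automorphisms of the Hopf surface. -/
def AutH (D : HopfData) : Subgroup (HopfSurface D ≃ₜ HopfSurface D) where
  carrier := {h | MDifferentiable 𝓘(ℂ, ℂ × ℂ) 𝓘(ℂ, ℂ × ℂ) h ∧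
    MDifferentiable 𝓘(ℂ, ℂ × ℂ) 𝓘(ℂ, ℂ × ℂ) h.symm}
  one_mem' := ⟨mdifferentiable_id, mdifferentiable_id⟩
  mul_mem' := fun ha hb => ⟨ha.1.comp hb.1, hb.2.comp ha.2⟩
  inv_mem' := fun ha => ⟨ha.2, ha.1⟩

/-! ### The Reeb component -/

/-- The half-line `[0, ∞)` as a model with boundary. -/
noncomputable def halfLine : ModelWithCorners ℝ ℝ ℝ≥0 :=
  ModelWithCorners.ofConvexRange
    { toFun := fun x => (x : ℝ)
      invFun := Real.toNNReal
      source := Set.univ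
      target := Set.Ici 0
      map_source' := fun x _ => x.2
      map_target' := fun _ _ => Set.mem_univ _
      left_inv' := fun x _ => Real.toNNReal_coe
      right_inv' := fun x hx => Real.coe_toNNReal x hx }
    rfl (convex_Ici 0) NNReal.continuous_coe continuous_real_toNNReal
    (by simp)

/-- The model `ℂ² × [0, ∞)` of the Reeb component, a real manifold with boundary. -/
noncomputable abbrev reebModel :
    ModelWithCorners ℝ ((ℂ × ℂ) × ℝ) (ModelProd (ℂ × ℂ) ℝ≥0) :=
  𝓘(ℝ, ℂ × ℂ).prod halfLine

/-- A smooth diffeomorphism of `[0, ∞)` with `φ x > x` for all `x > 0`. -/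
structure Holonomy where
  φ : ℝ≥0 ≃ₘ^∞⟮halfLine, halfLine⟯ ℝ≥0
  lt_apply : ∀ x, 0 < x → x < φ x

theorem Holonomy.apply_zero (P : Holonomy) : P.φ 0 = 0 := by
  by_contra h
  obtain ⟨b, hb⟩ := P.φ.surjective 0
  have hb0 : b ≠ 0 := by
    rintro rfl
    exact h hb
  have := P.lt_apply b (pos_iff_ne_zero.2 hb0)
  replace hb : P.φ b = 0 := hb
  rw [hb] at this
  exact not_lt_zero this

/-- The manifold `R̃ = ℂ² × [0, ∞) ∖ {(0, 0)}`. -/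
def Rt : TopologicalSpace.Opens ((ℂ × ℂ) × ℝ≥0) := ⟨{q | q ≠ 0}, isOpen_ne⟩

/-- The diffeomorphism `T = G × φ` of `R̃`. -/
noncomputable def reebT (D : HopfData) (P : Holonomy) : Rt ≃ₜ Rt :=
  (D.G.prodCongr P.φ.toHomeomorph).subtype fun q => by
    have h0 : (D.G.prodCongr P.φ.toHomeomorph) 0 = 0 :=
      Prod.ext D.G_zero P.apply_zero
    change q ≠ 0 ↔ (D.G.prodCongr P.φ.toHomeomorph) q ≠ 0
    rw [not_iff_not]
    constructor
    · rintro rfl; exact h0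
    · intro h; exact (D.G.prodCongr P.φ.toHomeomorph).injective (h.trans h0.symm)

/-- The LC Reeb component `R = R̃ / ⟨T⟩`. -/
def Reeb (D : HopfData) (P : Holonomy) : Type := OrbitSpace (reebT D P)

noncomputable instance (D : HopfData) (P : Holonomy) : TopologicalSpace (Reeb D P) :=
  inferInstanceAs (TopologicalSpace (OrbitSpace (reebT D P)))

/-- The covering map `R̃ → R`. -/
noncomputable def projR (D : HopfData) (P : Holonomy) : Rt → Reeb D P := proj (reebT D P)

theorem projR_isLocalHomeomorph (D : HopfData) (P : Holonomy) :
    IsLocalHomeomorph (proj (reebT D P)) := by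
  refine proj_isLocalHomeomorph (reebT D P) (fun q => D.height q.1.1 + (q.1.2 : ℝ)) ?_ ?_
  · have := D.continuous_height
    fun_prop
  · rintro ⟨⟨z, x⟩, hq⟩
    change D.height z + (x : ℝ) < D.height (D.G z) + (P.φ x : ℝ)
    by_cases hx : x = 0
    · have hz : z ≠ 0 := by
        rintro rfl
        exact hq (Prod.ext rfl hx)
      rw [hx, P.apply_zero]
      linarith [D.height_lt hz]
    · have h1 : (x : ℝ) < P.φ x := NNReal.coe_lt_coe.2 (P.lt_apply x (pos_iff_ne_zero.2 hx))
      linarith [D.height_le z]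

/-- The charts of `R` are the local inverses of the covering map `R̃ → R`; the coordinate changes
are restrictions of powers of `T`, so these are foliated charts of a leafwise complex foliation. -/
noncomputable instance (D : HopfData) (P : Holonomy) :
    ChartedSpace (ModelProd (ℂ × ℂ) ℝ≥0) (Reeb D P) :=
  orbitChartedSpace (ModelProd (ℂ × ℂ) ℝ≥0) (reebT D P) (projR_isLocalHomeomorph D P)

/-- `R` is a smooth manifold with boundary. -/
instance (D : HopfData) (P : Holonomy) : IsManifold reebModel ∞ (Reeb D P) := by
  refine orbitSpace_isManifold reebModel ∞ (reebT D P) (projR_isLocalHomeomorph D P) ?_ ?_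
  · rw [← ContMDiff.subtypeVal_comp_iff]
    have : ContMDiff 𝓘(ℝ, ℂ × ℂ) 𝓘(ℝ, ℂ × ℂ) ∞
        (fun z : ℂ × ℂ => (D.lam * z.1 + D.tau * z.2 ^ D.p, D.mu * z.2)) := by
      rw [contMDiff_iff_contDiff]; fun_prop
    exact (this.prodMap P.φ.contMDiff).comp contMDiff_subtype_val
  · rw [← ContMDiff.subtypeVal_comp_iff]
    have : ContMDiff 𝓘(ℝ, ℂ × ℂ) 𝓘(ℝ, ℂ × ℂ) ∞ (fun w : ℂ × ℂ =>
        ((w.1 - D.tau * (w.2 / D.mu) ^ D.p) / D.lam, w.2 / D.mu)) := by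
      rw [contMDiff_iff_contDiff]
      simp only [div_eq_mul_inv]
      fun_prop
    exact (this.prodMap P.φ.symm.contMDiff).comp contMDiff_subtype_val

/-- The leaf of the foliation of `R` which is the image of the leaf of `R̃` at height `x`: this is
`ℂ² × {x}` for `x > 0`, and `W × {0}` for `x = 0`. -/
def leaf (D : HopfData) (P : Holonomy) (x : ℝ≥0) : Set (Reeb D P) :=
  projR D P '' {q | q.1.2 = x}

/-- A self-map of `R` is leafwise holomorphic and smooth if it is smooth, maps every leaf into a
leaf, and its differential maps the tangent space `ℂ² × {0}` of a leaf complex-linearly to the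
tangent space of a leaf. -/
def IsLeafwiseHolomorphic {D : HopfData} {P : Holonomy} (f : Reeb D P → Reeb D P) : Prop :=
  ContMDiff reebModel reebModel ∞ f ∧
  (∀ x, ∃ y, Set.MapsTo f (leaf D P x) (leaf D P y)) ∧
  ∀ q : Reeb D P, ∃ A : (ℂ × ℂ) →L[ℂ] (ℂ × ℂ), ∀ v : ℂ × ℂ,
    (mfderiv reebModel reebModel f q : (ℂ × ℂ) × ℝ → (ℂ × ℂ) × ℝ) (v, 0) = (A v, 0)

theorem IsLeafwiseHolomorphic.id {D : HopfData} {P : Holonomy} :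
    IsLeafwiseHolomorphic (id : Reeb D P → Reeb D P) := by
  refine ⟨contMDiff_id, fun x => ⟨x, Set.mapsTo_id _⟩, fun q => ⟨.id ℂ _, fun v => ?_⟩⟩
  rw [mfderiv_id]
  rfl

theorem IsLeafwiseHolomorphic.comp {D : HopfData} {P : Holonomy} {f g : Reeb D P → Reeb D P}
    (hf : IsLeafwiseHolomorphic f) (hg : IsLeafwiseHolomorphic g) :
    IsLeafwiseHolomorphic (f ∘ g) := by
  obtain ⟨hf1, hf2, hf3⟩ := hf
  obtain ⟨hg1, hg2, hg3⟩ := hg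
  refine ⟨hf1.comp hg1, fun x => ?_, fun q => ?_⟩
  · obtain ⟨y, hy⟩ := hg2 x
    obtain ⟨w, hw⟩ := hf2 y
    exact ⟨w, hw.comp hy⟩
  · obtain ⟨B, hB⟩ := hg3 q
    obtain ⟨A, hA⟩ := hf3 (g q)
    refine ⟨A.comp B, fun v => ?_⟩
    rw [mfderiv_comp q (hf1.mdifferentiableAt (by simp)) (hg1.mdifferentiableAt (by simp))]
    exact (congrArg (mfderiv reebModel reebModel f (g q) : (ℂ × ℂ) × ℝ → (ℂ × ℂ) × ℝ)
      (hB v)).trans (hA _)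

/-- The group of leafwise holomorphic smooth automorphisms of `R`: the diffeomorphisms that
preserve the foliation and restrict to biholomorphisms between leaves. -/
def AutR (D : HopfData) (P : Holonomy) : Subgroup (Reeb D P ≃ₜ Reeb D P) where
  carrier := {f | IsLeafwiseHolomorphic f ∧ IsLeafwiseHolomorphic f.symm}
  one_mem' := ⟨.id, .id⟩
  mul_mem' := fun ha hb => ⟨ha.1.comp hb.1, hb.2.comp ha.2⟩
  inv_mem' := fun ha => ⟨ha.2, ha.1⟩

theorem zero_height_mem (z : W) : ((z : ℂ × ℂ), (0 : ℝ≥0)) ∈ Rt := fun h =>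
  z.2 (congrArg Prod.fst h)

theorem reebT_zpow_zero (D : HopfData) (P : Holonomy) (n : ℤ) (z : W) :
    (reebT D P ^ n) ⟨(z, 0), zero_height_mem z⟩ =
      ⟨((D.GW ^ n) z, 0), zero_height_mem _⟩ := by
  have h1 : ∀ z : W, reebT D P ⟨(z, 0), zero_height_mem z⟩ =
      ⟨(D.GW z, 0), zero_height_mem _⟩ :=
    fun z => Subtype.ext (Prod.ext rfl P.apply_zero)
  have h2 : ∀ (k : ℕ) (z : W), (reebT D P ^ k) ⟨(z, 0), zero_height_mem z⟩ =
      ⟨((D.GW ^ k) z, 0), zero_height_mem _⟩ := by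
    intro k
    induction k with
    | zero => intro z; rfl
    | succ k ih =>
      intro z
      simp only [pow_succ, Homeomorph.mul_apply]
      rw [h1, ih]
  rcases n with k | k
  · exact h2 k z
  · rw [zpow_negSucc, zpow_negSucc]
    apply (reebT D P ^ (k + 1)).injective
    rw [h2, ← Homeomorph.mul_apply]
    have : (D.GW ^ (k + 1)) ((D.GW ^ (k + 1))⁻¹ z) = z := by
      rw [← Homeomorph.mul_apply, mul_inv_cancel]; rfl
    rw [mul_inv_cancel, Homeomorph.one_apply]
    simp only [this]

/-- The inclusion of `H` in `R` as the boundary leaf, `[z] ↦ [(z, 0)]`. -/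
noncomputable def boundaryInclusion (D : HopfData) (P : Holonomy) : HopfSurface D → Reeb D P :=
  Quotient.map (fun z : W => (⟨(z, 0), zero_height_mem z⟩ : Rt)) (by
    rintro z w ⟨n, rfl⟩
    exact ⟨n, reebT_zpow_zero D P n z⟩)

theorem boundaryInclusion_injective (D : HopfData) (P : Holonomy) :
    Function.Injective (boundaryInclusion D P) := by
  rintro ⟨z⟩ ⟨w⟩ h
  obtain ⟨n, hn⟩ := (proj_eq_iff (reebT D P)).1 h
  rw [reebT_zpow_zero] at hn
  exact (proj_eq_iff D.GW).2 ⟨n, Subtype.ext (congrArg (fun q => q.1.1) hn)⟩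

end LCReeb

/-! Restriction to `H` is well defined for a topological reason. A leaf at height `x > 0` contains
points at every height `φ⁻ⁿ x`, and these heights tend to 0, so the leaf accumulates on the
boundary. Hence `H` is the only closed leaf and every automorphism preserves it (`leaf_closed_iff`,
`mapsTo_leaf_zero`). The restriction is holomorphic because the leafwise differential of `f` at the
boundary is complex-linear (`mdifferentiable_of_boundaryInclusion`).

Surjectivity rests on lifting. The projection `W → H` is a covering map and `W` is simply connected
in the sense needed for lifts: it is the union of two star-shaped open sets with connected
intersection. So `h` lifts to a homeomorphism `g` of `W`, which is holomorphic since the covering is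
a local biholomorphism, and Hartogs' theorem extends `g` to a biholomorphism `F` of `ℂ²` fixing the
origin.

The lift normalises the infinite cyclic deck group, so it conjugates `G` to `G` or to `G⁻¹`. The
second case is impossible: backward orbits of `G` converge to the origin, `F` is continuous there,
and forward orbits move away from it (`HopfData.not_conj_inv`). Thus `F` commutes with `G`, the
product `F × id` commutes with `T`, and it descends to an automorphism of `R` whose restriction to
`H` is `h`. -/

/-! ### Holomorphic functions of several variables: Cauchy estimates and smoothness. -/

section SeveralComplexVariables

open Metric Set MeasureTheory

variable {E F : Type*} [NormedAddCommGroup E] [NormedSpace ℂ E]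
  [NormedAddCommGroup F] [NormedSpace ℂ F]

/-- Cauchy estimate for the Fréchet derivative. -/
theorem norm_fderiv_le_of_differentiableOn_ball {g : E → F} {z : E} {r C : ℝ} (hr : 0 < r)
    (hg : DifferentiableOn ℂ g (ball z r)) (hC : ∀ y ∈ ball z r, ‖g y‖ ≤ C) :
    ‖fderiv ℂ g z‖ ≤ C / (r / 2) := by
  have hC0 : 0 ≤ C := (norm_nonneg _).trans (hC z (mem_ball_self hr))
  refine ContinuousLinearMap.opNorm_le_bound _ (by positivity) fun v => ?_
  rcases eq_or_ne v 0 with rfl | hv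
  · simp
  have hv' : 0 < ‖v‖ := norm_pos_iff.2 hv
  -- The radius is chosen so that the closed disc in direction `v` stays at distance at most `r / 2`
  -- from `z`; the one-variable Cauchy estimate on it carries exactly the factor `‖v‖`.
  have hmem : ∀ t ∈ closedBall (0 : ℂ) (r / 2 / ‖v‖), z + t • v ∈ ball z r := by
    intro t ht
    rw [mem_closedBall_zero_iff, le_div_iff₀ hv'] at ht
    simp only [mem_ball_iff_norm, add_sub_cancel_left, norm_smul]
    linarith
  have hline : ∀ t : ℂ, HasFDerivAt (fun t : ℂ => z + t • v)
      ((ContinuousLinearMap.id ℂ ℂ).smulRight v) t := fun t =>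
    ((ContinuousLinearMap.id ℂ ℂ).smulRight v).hasFDerivAt.const_add z
  have hdiff : ∀ t ∈ closedBall (0 : ℂ) (r / 2 / ‖v‖), HasFDerivAt (fun t : ℂ => g (z + t • v))
      ((fderiv ℂ g (z + t • v)).comp ((ContinuousLinearMap.id ℂ ℂ).smulRight v)) t := by
    intro t ht
    have h1 : DifferentiableAt ℂ g (z + t • v) :=
      (hg _ (hmem t ht)).differentiableAt (isOpen_ball.mem_nhds (hmem t ht))
    exact h1.hasFDerivAt.comp t (hline t)
  have hR : 0 < r / 2 / ‖v‖ := by positivity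
  have key := Complex.norm_deriv_le_of_forall_mem_sphere_norm_le (c := 0) (C := C)
    (f := fun t : ℂ => g (z + t • v)) hR
    (DifferentiableOn.diffContOnCl_ball (U := closedBall 0 (r / 2 / ‖v‖))
      (fun t ht => (hdiff t ht).differentiableAt.differentiableWithinAt) subset_rfl)
    (fun t ht => hC _ (hmem t (sphere_subset_closedBall ht)))
  have h0 := (hdiff 0 (mem_closedBall_self hR.le)).hasDerivAt.deriv
  rw [h0] at key
  simp only [zero_smul, add_zero, ContinuousLinearMap.comp_apply,
    ContinuousLinearMap.smulRight_apply, ContinuousLinearMap.id_apply, one_smul] at key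
  refine key.trans (le_of_eq ?_)
  field_simp

variable [FiniteDimensional ℂ E] [FiniteDimensional ℂ F]

/-- An average of translates of a holomorphic function is holomorphic. -/
theorem differentiableAt_integral_translate {U : Set E} (hU : IsOpen U) {g : E → F}
    (hg : DifferentiableOn ℂ g U) {w : ℝ → E} (hw : Continuous w) {k : ℝ → ℂ}
    (hk : Continuous k) {a b : ℝ} {z₀ : E} (hz : ∀ θ ∈ uIcc a b, z₀ + w θ ∈ U) :
    DifferentiableAt ℂ (fun z => ∫ θ in a..b, k θ • g (z + w θ)) z₀ := by
  have : ProperSpace E := FiniteDimensional.proper ℂ E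
  have : CompleteSpace F := FiniteDimensional.complete ℂ F
  have hK : IsCompact ((fun θ => z₀ + w θ) '' uIcc a b) :=
    isCompact_uIcc.image (by fun_prop)
  -- A compact thickening inside `U` bounds `g` uniformly. Moving `z` by `δ / 2` leaves balls of
  -- radius `δ / 2` inside it, so the Cauchy estimate dominates the derivatives and allows
  -- differentiation under the integral.
  obtain ⟨δ, hδ, hδU⟩ := hK.exists_cthickening_subset_open hU (image_subset_iff.2 hz)
  have hK' := hK.cthickening (r := δ)
  obtain ⟨C, hC⟩ := hK'.exists_bound_of_continuousOn (hg.continuousOn.mono hδU)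
  have hball : ∀ z ∈ ball z₀ (δ / 2), ∀ θ ∈ uIcc a b,
      ball (z + w θ) (δ / 2) ⊆ cthickening δ ((fun θ => z₀ + w θ) '' uIcc a b) := by
    intro z hz θ hθ y hy
    refine mem_cthickening_of_dist_le y _ δ _ (mem_image_of_mem _ hθ) ?_
    have h1 : dist (z + w θ) (z₀ + w θ) < δ / 2 := by simpa using hz
    have := dist_triangle y (z + w θ) (z₀ + w θ)
    have := mem_ball.1 hy
    linarith
  have hmem : ∀ z ∈ ball z₀ (δ / 2), ∀ θ ∈ uIcc a b, z + w θ ∈ U := fun z hz θ hθ =>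
    hδU (hball z hz θ hθ (mem_ball_self (by positivity)))
  have hcont : ∀ z ∈ ball z₀ (δ / 2), ContinuousOn (fun θ => k θ • g (z + w θ)) (uIcc a b) :=
    fun z hz => hk.continuousOn.smul
      (hg.continuousOn.comp (by fun_prop) fun θ hθ => hmem z hz θ hθ)
  borelize E
  refine (intervalIntegral.hasFDerivAt_integral_of_dominated_of_fderiv_le (𝕜 := ℂ)
    (F' := fun z θ => k θ • fderiv ℂ g (z + w θ))
    (bound := fun θ => ‖k θ‖ * (C / (δ / 2 / 2))) (ball_mem_nhds z₀ (half_pos hδ)) ?_ ?_ ?_ ?_ ?_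
    ?_).differentiableAt
  · filter_upwards [ball_mem_nhds z₀ (half_pos hδ)] with z hz
    exact ((hcont z hz).mono uIoc_subset_uIcc).aestronglyMeasurable measurableSet_uIoc
  · exact (hcont z₀ (mem_ball_self (half_pos hδ))).intervalIntegrable
  · refine hk.aestronglyMeasurable.smul ?_
    borelize (E →L[ℂ] F)
    have : FiniteDimensional ℂ (E →L[ℂ] F) := inferInstance
    have : ProperSpace (E →L[ℂ] F) := FiniteDimensional.proper ℂ _
    exact ((measurable_fderiv ℂ g).comp
      (by fun_prop : Continuous fun θ => z₀ + w θ).measurable).aestronglyMeasurable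
  · refine Filter.Eventually.of_forall fun θ hθ z hz => ?_
    rw [norm_smul]
    have hb := hball z hz θ (uIoc_subset_uIcc hθ)
    exact mul_le_mul_of_nonneg_left (norm_fderiv_le_of_differentiableOn_ball (half_pos hδ)
      (hg.mono (hb.trans hδU)) fun y hy => hC y (hb hy)) (norm_nonneg _)
  · exact (hk.norm.mul continuous_const).intervalIntegrable _ _
  · refine Filter.Eventually.of_forall fun θ hθ z hz => ?_
    have h1 := hmem z hz θ (uIoc_subset_uIcc hθ)
    have h2 : HasFDerivAt g (fderiv ℂ g (z + w θ)) (z + w θ) :=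
      ((hg _ h1).differentiableAt (hU.mem_nhds h1)).hasFDerivAt
    exact ((hasFDerivAt_comp_add_right (w θ)).2 h2).const_smul (k θ)

-- In a basis of `E`, an operator is a finite tuple of values, so differentiability can be tested on
-- each vector.
omit [FiniteDimensional ℂ F] in
theorem differentiableAt_of_forall_clm_apply {f : E → E →L[ℂ] F} {z : E}
    (h : ∀ v, DifferentiableAt ℂ (fun y => f y v) z) : DifferentiableAt ℂ f z := by
  let d := Module.finrank ℂ E
  have hd : d = Module.finrank ℂ (Fin d → ℂ) := (Module.finrank_fin_fun ℂ).symm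
  let e₁ := ContinuousLinearEquiv.ofFinrankEq hd
  let e₂ := (e₁.arrowCongr (1 : F ≃L[ℂ] F)).trans (ContinuousLinearEquiv.piRing (Fin d))
  rw [← Function.id_comp f, ← e₂.symm_comp_self]
  exact e₂.symm.differentiableAt.comp z (differentiableAt_pi.2 fun i => h _)

/-- The derivative of a holomorphic function of several variables is holomorphic. -/
theorem Differentiable.differentiable_fderiv_complex {g : E → F} (hg : Differentiable ℂ g) :
    Differentiable ℂ (fderiv ℂ g) := by
  have : CompleteSpace F := FiniteDimensional.complete ℂ F
  intro z
  refine differentiableAt_of_forall_clm_apply fun v => ?_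
  -- Cauchy's formula for the first derivative, on the unit circle in the line through `y` in
  -- direction `v`, makes this a weighted average of translates of `g`.
  have h1 : (fun y => fderiv ℂ g y v) = fun y => (2 * Real.pi * Complex.I : ℂ)⁻¹ •
      ∫ θ in 0..2 * Real.pi, (_root_.deriv (circleMap 0 1) θ * (circleMap 0 1 θ ^ 2)⁻¹) •
        g (y + circleMap 0 1 θ • v) := by
    funext y
    have h2 : HasFDerivAt (fun t : ℂ => y + t • v)
      ((ContinuousLinearMap.id ℂ ℂ).smulRight v) 0 :=
      ((ContinuousLinearMap.id ℂ ℂ).smulRight v).hasFDerivAt.const_add y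
    have h3 : HasDerivAt (fun t : ℂ => g (y + t • v)) (fderiv ℂ g y v) 0 := by
      have h4 : HasFDerivAt g (fderiv ℂ g y) (y + (0 : ℂ) • v) := by
        simpa using (hg y).hasFDerivAt
      have h5 : HasFDerivAt (fun t : ℂ => g (y + t • v)) _ 0 := h4.comp (0 : ℂ) h2
      simpa using h5.hasDerivAt
    rw [← h3.deriv, ← Complex.two_pi_I_inv_smul_circleIntegral_sub_sq_inv_smul_of_differentiable
      isOpen_univ (c := 0) (R := 1) (subset_univ _)
      (f := fun t : ℂ => g (y + t • v)) (by fun_prop) (by simp)]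
    simp only [circleIntegral, sub_zero, smul_smul]
  rw [h1]
  refine (differentiableAt_integral_translate isOpen_univ hg.differentiableOn (by fun_prop) ?_
    (by simp)).const_smul _
  have hd : _root_.deriv (circleMap 0 1) = fun θ => circleMap 0 1 θ * Complex.I :=
    funext fun θ => deriv_circleMap 0 1 θ
  rw [hd]
  refine Continuous.mul (by fun_prop) (Continuous.inv₀ (by fun_prop) fun θ => ?_)
  simp

end SeveralComplexVariables

/-- A holomorphic function of several variables is smooth. -/
theorem Differentiable.contDiff_complex {E : Type*} [NormedAddCommGroup E] [NormedSpace ℂ E]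
    [FiniteDimensional ℂ E] {g : E → E} (hg : Differentiable ℂ g) : ContDiff ℂ ∞ g := by
  -- The target must vary in the induction, since passing to the derivative replaces `F` by `E →L[ℂ]
  -- F`.
  have key : ∀ n : ℕ, ∀ {F : Type _} [NormedAddCommGroup F] [NormedSpace ℂ F]
      [FiniteDimensional ℂ F] {g : E → F}, Differentiable ℂ g → ContDiff ℂ n g := by
    intro n
    induction n with
    | zero => intro F _ _ _ g hg; exact contDiff_zero.2 hg.continuous
    | succ n ih =>
      intro F _ _ _ g hg
      push_cast
      rw [contDiff_succ_iff_fderiv]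
      exact ⟨hg, by simp, ih hg.differentiable_fderiv_complex⟩
  exact contDiff_infty.2 fun n => key n hg

/-! ### Hartogs extension. -/

/-- Hartogs extension across the origin: a holomorphic map on `ℂ² ∖ {0}` extends to `ℂ²`. -/
theorem exists_differentiable_extension {F : Type*} [NormedAddCommGroup F] [NormedSpace ℂ F]
    [FiniteDimensional ℂ F] {g : ℂ × ℂ → F} (hg : DifferentiableOn ℂ g {0}ᶜ) :
    ∃ f : ℂ × ℂ → F, Differentiable ℂ f ∧ Set.EqOn f g {0}ᶜ := by
  have : CompleteSpace F := FiniteDimensional.complete ℂ F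
  -- For `‖z‖ < 1` the circle of radius 1 about `z` in the first coordinate avoids the origin, so
  -- the mean of `g` over it is defined and holomorphic even at `z = 0`.
  let A : ℂ × ℂ → F := fun z => (2 * Real.pi : ℂ)⁻¹ •
    ∫ θ in 0..2 * Real.pi, (1 : ℂ) • g (z + (circleMap 0 1 θ, 0))
  have hmem : ∀ z ∈ Metric.ball (0 : ℂ × ℂ) 1, ∀ θ : ℝ,
      z + ((circleMap 0 1 θ, 0) : ℂ × ℂ) ∈ ({0}ᶜ : Set (ℂ × ℂ)) := by
    intro z hz θ h
    have h1 : z.1 + circleMap 0 1 θ = 0 := congrArg Prod.fst h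
    have h2 : ‖z.1‖ < 1 := (norm_fst_le z).trans_lt (mem_ball_zero_iff.1 hz)
    rw [eq_neg_of_add_eq_zero_left h1] at h2
    simp at h2
  have hA : ∀ z ∈ Metric.ball (0 : ℂ × ℂ) 1, DifferentiableAt ℂ A z := fun z hz =>
    (differentiableAt_integral_translate isOpen_compl_singleton hg (by fun_prop)
      continuous_const fun θ _ => hmem z hz θ).const_smul _
  -- When `z.2 ≠ 0` the whole horizontal line through `z` misses the origin, and the mean value
  -- property applies. Points with `z.2 = 0` are then reached by continuity.
  have hAg : ∀ z ∈ Metric.ball (0 : ℂ × ℂ) 1, z.2 ≠ 0 → A z = g z := by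
    intro z hz hz2
    have hd : Differentiable ℂ fun t : ℂ => g (z + (t, 0)) := by
      intro t
      have h1 : z + ((t, 0) : ℂ × ℂ) ∈ ({0}ᶜ : Set (ℂ × ℂ)) := fun h =>
        hz2 (by simpa using congrArg Prod.snd h)
      have h2 := (hg _ h1).differentiableAt (isOpen_compl_singleton.mem_nhds h1)
      exact h2.comp t (by fun_prop)
    have h3 := (hd.diffContOnCl (s := Metric.ball 0 |1|)).circleAverage
    simp only [Real.circleAverage_def] at h3
    have h4 : z + ((0, 0) : ℂ × ℂ) = z := by simp
    rw [h4] at h3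
    simp only [A, one_smul]
    rw [← h3, ← Complex.coe_smul]
    push_cast
    rfl
  have hAg' : ∀ z ∈ Metric.ball (0 : ℂ × ℂ) 1, z ≠ 0 → A z = g z := by
    intro z hz hz0
    by_cases hz2 : z.2 = 0
    · have hlim : Filter.Tendsto (fun n : ℕ => z + ((0, 1 / ((n : ℂ) + 1)) : ℂ × ℂ))
          Filter.atTop (𝓝 z) := by
        have h1 : Filter.Tendsto (fun n : ℕ => 1 / ((n : ℂ) + 1)) Filter.atTop (𝓝 0) :=
          tendsto_one_div_add_atTop_nhds_zero_nat
        have h2 := (tendsto_const_nhds (x := (0 : ℂ))).prodMk_nhds h1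
        have h3 := h2.const_add z
        rwa [Prod.mk_zero_zero, add_zero] at h3
      have hgc : ContinuousAt g z :=
        ((hg z hz0).differentiableAt (isOpen_compl_singleton.mem_nhds hz0)).continuousAt
      refine tendsto_nhds_unique ((hA z hz).continuousAt.tendsto.comp hlim)
        ((hgc.tendsto.comp hlim).congr' ?_)
      filter_upwards [hlim.eventually (Metric.isOpen_ball.mem_nhds hz)] with n hn
      refine (hAg _ hn ?_).symm
      simp only [Prod.snd_add, hz2, zero_add]
      exact one_div_ne_zero (Nat.cast_add_one_ne_zero n)
    · exact hAg z hz hz2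
  refine ⟨Function.update g 0 (A 0), fun z => ?_, fun z hz => Function.update_of_ne hz _ _⟩
  by_cases hz : z = 0
  · subst hz
    refine (hA 0 (by simp)).congr_of_eventuallyEq ?_
    filter_upwards [Metric.ball_mem_nhds (0 : ℂ × ℂ) one_pos] with y hy
    by_cases hy0 : y = 0
    · simp [hy0]
    · rw [Function.update_of_ne hy0, hAg' y hy hy0]
  · refine ((hg z hz).differentiableAt
      (isOpen_compl_singleton.mem_nhds hz)).congr_of_eventuallyEq ?_
    filter_upwards [isOpen_compl_singleton.mem_nhds hz] with y hy
    exact Function.update_of_ne hy _ _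

/-! ### Lifting through coverings over the punctured plane `ℂ² ∖ {0}`. -/

/-- Lifting through a covering map over the union of two simply connected open sets with connected
intersection. -/
theorem IsCoveringMap.exists_continuousOn_lift_union {A E X : Type*} [TopologicalSpace A]
    [LocallyPathConnectedSpace A] [TopologicalSpace E] [TopologicalSpace X] {p : E → X}
    (hp : IsCoveringMap p) {s t : Set A} (hs : IsOpen s) (ht : IsOpen t)
    [SimplyConnectedSpace s] [SimplyConnectedSpace t] (hst : IsPreconnected (s ∩ t))
    {f : A → X} (hf : ContinuousOn f (s ∪ t)) {a₀ : A} (ha₀ : a₀ ∈ s ∩ t) {e₀ : E}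
    (he₀ : p e₀ = f a₀) :
    ∃ g : A → E, ContinuousOn g (s ∪ t) ∧ g a₀ = e₀ ∧ ∀ a ∈ s ∪ t, p (g a) = f a := by
  classical
  have hlift : ∀ u : Set A, IsOpen u → SimplyConnectedSpace u → u ⊆ s ∪ t → a₀ ∈ u →
      ∃ g : A → E, ContinuousOn g u ∧ g a₀ = e₀ ∧ ∀ a ∈ u, p (g a) = f a := by
    intro u hu _ hsub ha
    have := hu.locallyPathConnectedSpace
    obtain ⟨F, ⟨hF1, hF2⟩, -⟩ := hp.existsUnique_continuousMap_lifts
      (⟨u.domRestrict f, (hf.mono hsub).domRestrict⟩ : C(u, X)) ⟨a₀, ha⟩ e₀ he₀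
    refine ⟨fun a => if h : a ∈ u then F ⟨a, h⟩ else e₀, ?_, by simp [ha, hF1], fun a h => ?_⟩
    · rw [continuousOn_iff_continuous_domRestrict]
      convert! F.continuous with a
      simp
    · simpa [h] using congrFun hF2 ⟨a, h⟩
  obtain ⟨g₁, hg₁, hg₁', hpg₁⟩ := hlift s hs inferInstance Set.subset_union_left ha₀.1
  obtain ⟨g₂, hg₂, hg₂', hpg₂⟩ := hlift t ht inferInstance Set.subset_union_right ha₀.2
  -- Uniqueness of lifts on the connected intersection, where both take the value `e₀` at `a₀`, lets
  -- the two lifts be glued.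
  have heq : ∀ a ∈ s ∩ t, g₁ a = g₂ a := by
    have := Subtype.preconnectedSpace hst
    have h := hp.eq_of_comp_eq (g₁ := (s ∩ t).domRestrict g₁) (g₂ := (s ∩ t).domRestrict g₂)
      (hg₁.mono Set.inter_subset_left).domRestrict (hg₂.mono Set.inter_subset_right).domRestrict
      (funext fun a => (hpg₁ a a.2.1).trans (hpg₂ a a.2.2).symm) ⟨a₀, ha₀⟩ (hg₁'.trans hg₂'.symm)
    exact fun a ha => congrFun h ⟨a, ha⟩
  refine ⟨s.piecewise g₁ g₂, ?_, by rw [Set.piecewise_eq_of_mem _ _ _ ha₀.1, hg₁'], ?_⟩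
  · refine ContinuousOn.union_of_isOpen (hg₁.congr fun a ha => Set.piecewise_eq_of_mem _ _ _ ha)
      (hg₂.congr fun a ha => ?_) hs ht
    by_cases h : a ∈ s
    · rw [Set.piecewise_eq_of_mem _ _ _ h, heq a ⟨h, ha⟩]
    · exact Set.piecewise_eq_of_notMem _ _ _ h
  · intro a ha
    by_cases h : a ∈ s
    · rw [Set.piecewise_eq_of_mem _ _ _ h, hpg₁ a h]
    · rw [Set.piecewise_eq_of_notMem _ _ _ h, hpg₂ a (ha.resolve_left h)]

/-- `ℂ²` minus a real ray. -/
def slitPlaneProd : Set (ℂ × ℂ) := {z | z.2 ≠ 0 ∨ z.1 ∈ Complex.slitPlane}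

theorem isOpen_slitPlaneProd : IsOpen slitPlaneProd :=
  (isOpen_ne_fun continuous_snd continuous_const).union
    (Complex.isOpen_slitPlane.preimage continuous_fst)

/-- On the segment from `(1, 0)` to a point with nonzero second coordinate, that coordinate vanishes
only at the start; otherwise the slit plane itself is star-shaped about 1. -/
theorem starConvex_slitPlaneProd : StarConvex ℝ ((1, 0) : ℂ × ℂ) slitPlaneProd := by
  rintro z hz a b ha hb hab
  rcases hz with hz | hz
  · by_cases hb0 : b = 0
    · right
      have : a = 1 := by linarith
      simp [hb0, this]
    · left
      simp [hb0, hz]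
  · right
    simpa using Complex.starConvex_one_slitPlane hz ha hb hab

instance : SimplyConnectedSpace slitPlaneProd := by
  have : ContractibleSpace slitPlaneProd :=
    starConvex_slitPlaneProd.contractibleSpace ⟨(1, 0), by simp [slitPlaneProd]⟩
  infer_instance

instance : SimplyConnectedSpace (-slitPlaneProd : Set (ℂ × ℂ)) := by
  have : ContractibleSpace (-slitPlaneProd : Set (ℂ × ℂ)) :=
    starConvex_slitPlaneProd.neg.contractibleSpace ⟨(-1, 0), by simp [slitPlaneProd]⟩
  infer_instance

/-- The two removed rays are opposite and meet only at the origin. -/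
theorem slitPlaneProd_union_neg : slitPlaneProd ∪ -slitPlaneProd = {0}ᶜ := by
  ext z
  have h1 : z.1 = 0 ↔ z.1.re = 0 ∧ z.1.im = 0 := Complex.ext_iff
  simp only [slitPlaneProd, Complex.mem_slitPlane_iff, Set.mem_union, Set.mem_ofPred_eq,
    Set.mem_neg, Prod.snd_neg, Prod.fst_neg, Complex.neg_re, Complex.neg_im, Set.mem_compl_iff,
    Set.mem_singleton_iff, Prod.ext_iff, Prod.fst_zero, Prod.snd_zero, h1]
  grind

/-- The two removed rays together form a real line, the kernel of `L`, and the complement of a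
subspace of real codimension 3 is connected. -/
theorem isConnected_slitPlaneProd_inter_neg : IsConnected (slitPlaneProd ∩ -slitPlaneProd) := by
  let L : ℂ × ℂ →ₗ[ℝ] ℝ × ℂ := Complex.imLm.prodMap LinearMap.id
  have hL : Function.Surjective L := fun y => ⟨(Complex.I * y.1, y.2), by simp [L]⟩
  have h : slitPlaneProd ∩ -slitPlaneProd = (LinearMap.ker L : Set (ℂ × ℂ))ᶜ := by
    ext z
    simp only [slitPlaneProd, Complex.mem_slitPlane_iff, Set.mem_inter_iff, Set.mem_ofPred_eq,
      Set.mem_neg, Prod.snd_neg, Prod.fst_neg, Complex.neg_re, Complex.neg_im, Set.mem_compl_iff,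
      SetLike.mem_coe, LinearMap.mem_ker, L, LinearMap.prodMap_apply, Prod.ext_iff,
      Prod.fst_zero, Prod.snd_zero, Complex.imLm_coe, LinearMap.id_apply]
    grind
  rw [h]
  refine isConnected_compl_of_one_lt_codim ?_
  rw [(L.quotKerEquivOfSurjective hL).rank_eq, ← Module.finrank_eq_rank]
  norm_num

/-! ### Orbit spaces as bases of covering maps. -/

namespace LCReeb

theorem proj_isQuotientMap {X : Type*} [TopologicalSpace X] (T : X ≃ₜ X) :
    Topology.IsQuotientMap (proj T) := isQuotientMap_quot_mk

theorem continuous_proj {X : Type*} [TopologicalSpace X] (T : X ≃ₜ X) : Continuous (proj T) :=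
  (proj_isQuotientMap T).continuous

/-- If some continuous function strictly increases along `T`, then the projection to the orbit
space is a covering map. -/
theorem proj_isCoveringMap {X : Type*} [TopologicalSpace X] (T : X ≃ₜ X) (N : X → ℝ)
    (hN : Continuous N) (h : ∀ x, N x < N (T x)) : IsCoveringMap (proj T) := by
  let _ : MulAction (Multiplicative ℤ) X :=
    { smul := fun n x => (T ^ n.toAdd) x
      one_smul := fun x => rfl
      mul_smul := fun m n x => by
        change (T ^ (m.toAdd + n.toAdd)) x = (T ^ m.toAdd) ((T ^ n.toAdd) x)
        rw [zpow_add, Homeomorph.mul_apply] }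
  have hsmul : ∀ (n : Multiplicative ℤ) (x : X), n • x = (T ^ n.toAdd) x := fun _ _ => rfl
  have hpow : ∀ (n : ℕ) x, N x ≤ N ((T ^ n) x) := by
    intro n
    induction n with
    | zero => intro x; simp
    | succ k ih =>
      intro x
      rw [pow_succ, Homeomorph.mul_apply]
      exact (h x).le.trans (ih (T x))
  suffices hq : IsQuotientCoveringMap (proj T) (Multiplicative ℤ) from hq.isCoveringMap
  refine
    { toIsQuotientMap := proj_isQuotientMap T
      continuous_const_smul := fun n => (T ^ n.toAdd).continuous
      apply_eq_iff_mem_orbit := fun {x y} => ?_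
      disjoint := fun x => ?_ }
  · rw [eq_comm, proj_eq_iff]
    exact ⟨fun ⟨n, hn⟩ => ⟨Multiplicative.ofAdd n, hn⟩, fun ⟨n, hn⟩ => ⟨n.toAdd, hn⟩⟩
  · obtain ⟨m, hm1, hm2⟩ := exists_between (h x)
    refine ⟨{y | N y < m ∧ m < N (T y)}, ((isOpen_lt hN continuous_const).inter
      (isOpen_lt continuous_const (hN.comp T.continuous))).mem_nhds ⟨hm1, hm2⟩, ?_⟩
    -- Once `N` has passed the level `m` it never returns below, so the neighbourhood is disjoint
    -- from all its nontrivial translates. Negative powers are handled by exchanging the two points.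
    have key : ∀ y z, m < N (T y) → N z < m → ∀ k : ℕ, (T ^ (k + 1)) y ≠ z := by
      rintro y z hy hz k rfl
      have := hpow k (T y)
      rw [pow_succ, Homeomorph.mul_apply] at hz
      linarith
    rintro n ⟨_, ⟨y, hy, rfl⟩, hz⟩
    simp only [hsmul] at hz
    by_contra hn
    obtain ⟨k, rfl⟩ | ⟨k, rfl⟩ : (∃ k : ℕ, n = Multiplicative.ofAdd ((k + 1 : ℕ) : ℤ)) ∨
        ∃ k : ℕ, n = Multiplicative.ofAdd (Int.negSucc k) := by
      rcases n with (_ | k) | k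
      · exact absurd rfl hn
      · exact .inl ⟨k, rfl⟩
      · exact .inr ⟨k, rfl⟩
    · refine key y _ hy.2 hz.1 k ?_
      rw [toAdd_ofAdd, zpow_natCast]
    · refine key _ y hz.2 hy.1 k ?_
      rw [toAdd_ofAdd, zpow_negSucc, ← Homeomorph.mul_apply, mul_inv_cancel, Homeomorph.one_apply]

instance : ConnectedSpace W := by
  have h : IsConnected ((W : Set (ℂ × ℂ))) := by
    refine isConnected_compl_singleton_of_one_lt_rank ?_ 0
    rw [← Module.finrank_eq_rank]
    norm_num [Module.finrank_prod, Complex.finrank_real_complex]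
  exact isConnected_iff_connectedSpace.1 h

/-- A continuous map from `W` to the base of a covering map lifts. -/
theorem exists_lift {E X : Type*} [TopologicalSpace E] [TopologicalSpace X] {p : E → X}
    (hp : IsCoveringMap p) {f : W → X} (hf : Continuous f) (a : W)
    (ha : a.1 ∈ slitPlaneProd ∩ -slitPlaneProd) (e : E) (he : p e = f a) :
    ∃ g : W → E, Continuous g ∧ g a = e ∧ ∀ z, p (g z) = f z := by
  classical
  let f' : ℂ × ℂ → X := fun z => if h : z ∈ W then f ⟨z, h⟩ else f a
  have hf' : ∀ z : W, f' z = f z := fun z => by simp [f']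
  have hW : (slitPlaneProd ∪ -slitPlaneProd : Set (ℂ × ℂ)) = W := slitPlaneProd_union_neg
  obtain ⟨g, hg, hga, hgp⟩ := hp.exists_continuousOn_lift_union (f := f') isOpen_slitPlaneProd
    isOpen_slitPlaneProd.neg isConnected_slitPlaneProd_inter_neg.isPreconnected (by
      rw [hW, continuousOn_iff_continuous_domRestrict]
      convert! hf
      exact funext hf') ha (he.trans (hf' a).symm)
  rw [hW] at hg hgp
  exact ⟨fun z => g z, hg.domRestrict, hga, fun z => (hgp z z.2).trans (hf' z)⟩

/-! ### Maps of an orbit space read in its charts. -/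

section Charts

open TopologicalSpace (Opens)

variable {𝕜 : Type*} [NontriviallyNormedField 𝕜] {E : Type*} [NormedAddCommGroup E]
  [NormedSpace 𝕜 E] {M : Type*} [TopologicalSpace M] (I : ModelWithCorners 𝕜 E M) {U : Opens M}

open Classical in
/-- A self-map of an open subset of the model space, read in the model vector space. -/
noncomputable def coordRep (σ : U → U) (v : E) : E :=
  if h : I.symm v ∈ U then I (σ ⟨I.symm v, h⟩ : M) else v

theorem coordRep_apply (σ : U → U) (z : U) : coordRep I σ (I (z : M)) = I (σ z : M) := by
  have h : I.symm (I (z : M)) = z := I.left_inv _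
  simp [coordRep, h]

theorem eventually_symm_mem (x : U) : ∀ᶠ v in 𝓝 (I (x : M)), I.symm v ∈ U :=
  (U.isOpen.preimage I.continuous_symm).mem_nhds (by simp)

theorem coordRep_eventuallyEq {σ ρ : U → U} {x : U} (h : σ =ᶠ[𝓝 x] ρ) :
    coordRep I σ =ᶠ[𝓝 (I (x : M))] coordRep I ρ := by
  obtain ⟨O, hO, hxO⟩ := (mem_nhds_subtype (U : Set M) x _).1 h
  have h1 : ∀ᶠ v in 𝓝 (I (x : M)), I.symm v ∈ O :=
    I.continuous_symm.continuousAt.eventually (by simpa using hO)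
  filter_upwards [h1, eventually_symm_mem I x] with v hv hU
  simp only [coordRep, hU, dite_true]
  exact congrArg (fun y : U => I (y : M)) (hxO (show (⟨I.symm v, hU⟩ : U) ∈ _ from hv))

theorem coordRep_comp (σ ρ : U → U) {v : E} (hU : I.symm v ∈ U) :
    coordRep I (σ ∘ ρ) v = coordRep I σ (coordRep I ρ v) := by
  have h1 : coordRep I ρ v = I (ρ ⟨I.symm v, hU⟩ : M) := by simp [coordRep, hU]
  rw [h1, coordRep_apply]
  simp [coordRep, hU]

variable (T : U ≃ₜ U) (hT : IsLocalHomeomorph (proj T))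

/-- A self-map of the orbit space read through a local inverse of the projection. -/
noncomputable def localLift (f : OrbitSpace T → OrbitSpace T) (q : OrbitSpace T) (z : U) : U :=
  hT.localInverseAt (Quotient.out (f q)) (f (proj T z))

theorem proj_out (q : OrbitSpace T) : proj T (Quotient.out q) = q := Quotient.out_eq q

theorem eventually_localInverseAt_eq {z : U} {y : OrbitSpace T} (hy : Quotient.out y = z) :
    ∀ᶠ w in 𝓝 z, hT.localInverseAt (Quotient.out y) (proj T w) = w := by
  subst hy
  have h : Quotient.out y ∈ (hT.localInverseAt (Quotient.out y)).target :=
    hT.self_mem_localInverseAt_target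
  filter_upwards [(hT.localInverseAt (Quotient.out y)).open_target.mem_nhds h] with w hw
  rw [← congrFun (hT.localInverseAt_symm (Quotient.out y)) w]
  exact (hT.localInverseAt (Quotient.out y)).right_inv hw

theorem out_mem_localInverseAt_source (y : OrbitSpace T) :
    y ∈ (hT.localInverseAt (Quotient.out y)).source := by
  have := hT.apply_self_mem_localInverseAt_source (x := Quotient.out y)
  rwa [proj_out] at this

theorem localInverseAt_out (y : OrbitSpace T) :
    hT.localInverseAt (Quotient.out y) y = Quotient.out y := by
  have := hT.localInverseAt_apply_self (x := Quotient.out y)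
  rwa [proj_out] at this

theorem localLift_out (f : OrbitSpace T → OrbitSpace T) (q : OrbitSpace T) :
    localLift T hT f q (Quotient.out q) = Quotient.out (f q) := by
  rw [localLift, proj_out, localInverseAt_out]

theorem continuousAt_localLift {f : OrbitSpace T → OrbitSpace T} {q : OrbitSpace T}
    (hf : ContinuousAt f q) : ContinuousAt (localLift T hT f q) (Quotient.out q) := by
  have h1 : ContinuousAt (hT.localInverseAt (Quotient.out (f q)))
      (f (proj T (Quotient.out q))) := by
    rw [proj_out]
    exact (hT.localInverseAt _).continuousAt (out_mem_localInverseAt_source T hT _)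
  have h2 : ContinuousAt f (proj T (Quotient.out q)) := by rwa [proj_out]
  exact ContinuousAt.comp (f := fun z => f (proj T z)) h1
    (h2.comp (continuous_proj T).continuousAt)

theorem eventually_proj_localLift {f : OrbitSpace T → OrbitSpace T} {q : OrbitSpace T}
    (hf : ContinuousAt f q) :
    ∀ᶠ z in 𝓝 (Quotient.out q), proj T (localLift T hT f q z) = f (proj T z) := by
  have h2 : ContinuousAt (fun z => f (proj T z)) (Quotient.out q) := by
    refine ContinuousAt.comp ?_ (continuous_proj T).continuousAt
    rwa [proj_out]
  have h3 : f (proj T (Quotient.out q)) ∈ (hT.localInverseAt (Quotient.out (f q))).source := by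
    rw [proj_out]
    exact out_mem_localInverseAt_source T hT _
  filter_upwards [h2.eventually ((hT.localInverseAt _).open_source.mem_nhds h3)] with z hz
  rw [localLift, ← congrFun (hT.localInverseAt_symm (Quotient.out (f q)))]
  exact (hT.localInverseAt _).left_inv hz

/-- A continuous local lift with the right value coincides with the one used by the charts. -/
theorem localLift_eventuallyEq {f : OrbitSpace T → OrbitSpace T} {q : OrbitSpace T} {σ : U → U}
    (hσ : ContinuousAt σ (Quotient.out q)) (hq : σ (Quotient.out q) = Quotient.out (f q))
    (h : ∀ᶠ z in 𝓝 (Quotient.out q), f (proj T z) = proj T (σ z)) :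
    localLift T hT f q =ᶠ[𝓝 (Quotient.out q)] σ := by
  filter_upwards [h, hσ.eventually (eventually_localInverseAt_eq T hT hq.symm)] with z hz hz'
  rw [localLift, hz, hz']

/-- A local homeomorphism carries the neighbourhood filter of `x` onto that of its image, so
continuity can be tested upstairs. -/
theorem continuousAt_of_lift (hT : IsLocalHomeomorph (proj T)) {f : OrbitSpace T → OrbitSpace T} {x : U} {σ : U → U}
    (hσ : ContinuousAt σ x) (h : ∀ᶠ z in 𝓝 x, f (proj T z) = proj T (σ z)) :
    ContinuousAt f (proj T x) := by
  have h1 : ContinuousAt (fun z => proj T (σ z)) x := (continuous_proj T).continuousAt.comp hσ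
  have h2 : ContinuousAt (fun z => f (proj T z)) x := h1.congr (h.mono fun z hz => hz.symm)
  rw [ContinuousAt, ← hT.map_nhds_eq, Filter.tendsto_map'_iff]
  exact h2

variable {cs : ChartedSpace M M} (hM : ∀ m : M, chartAt M m = OpenPartialHomeomorph.refl M)

include hM in
theorem extChartAt_opens_apply (x : U) (z : U) : extChartAt I x z = I (z : M) := by
  rw [extChartAt, TopologicalSpace.Opens.chartAt_eq, hM]
  rfl

include hM in
theorem extChartAt_opens_symm_apply (x : U) (z : U) :
    (extChartAt I x).symm (I (z : M)) = z := by
  rw [← extChartAt_opens_apply I hM x z]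
  refine (extChartAt I x).left_inv ?_
  rw [extChartAt_source, TopologicalSpace.Opens.chartAt_eq, hM]
  simp only [OpenPartialHomeomorph.subtypeRestr_source]
  exact Set.mem_univ _

include hM in
theorem extChartAt_orbitSpace (q : OrbitSpace T) :
    letI := orbitChartedSpace M T hT
    extChartAt I q q = I ((Quotient.out q : U) : M) := by
  refine Eq.trans ?_ (extChartAt_opens_apply I hM (Quotient.out q) (Quotient.out q))
  exact congrArg (extChartAt I (Quotient.out q : U)) (localInverseAt_out T hT q)

-- The inverse of the chart at `q` is `proj T` as a total function, so the identity holds at every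
-- model point over `U` and not just near the base point. The pointwise form is what the boundary
-- leaf requires.
include hM in
theorem writtenInExtChartAt_orbitSpace (f : OrbitSpace T → OrbitSpace T) (q : OrbitSpace T)
    {v : E} (hv : v ∈ Set.range I) (hU : I.symm v ∈ U) :
    letI := orbitChartedSpace M T hT
    writtenInExtChartAt I I q f v = coordRep I (localLift T hT f q) v := by
  obtain ⟨m, rfl⟩ := hv
  rw [I.left_inv] at hU
  have h1 := extChartAt_opens_symm_apply I hM (Quotient.out q) ⟨m, hU⟩
  have h2 := coordRep_apply I (localLift T hT f q) ⟨m, hU⟩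
  have h3 : (hT.localInverseAt (Quotient.out q)).symm ((extChartAt I (Quotient.out q)).symm (I m)) =
      proj T ⟨m, hU⟩ := by
    rw [h1]
    exact congrFun (hT.localInverseAt_symm (Quotient.out q)) _
  refine Eq.trans ?_ h2.symm
  refine Eq.trans ?_ (extChartAt_opens_apply I hM (Quotient.out (f q)) _)
  exact congrArg (fun y => extChartAt I (Quotient.out (f q) : U)
    (hT.localInverseAt (Quotient.out (f q)) (f y))) h3

include hM in
theorem writtenInExtChartAt_eventuallyEq (f : OrbitSpace T → OrbitSpace T) (q : OrbitSpace T) :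
    letI := orbitChartedSpace M T hT
    writtenInExtChartAt I I q f =ᶠ[𝓝[Set.range I] (I ((Quotient.out q : U) : M))]
      coordRep I (localLift T hT f q) := by
  filter_upwards [self_mem_nhdsWithin,
    mem_nhdsWithin_of_mem_nhds (eventually_symm_mem I (Quotient.out q))] with v hv hU
  exact writtenInExtChartAt_orbitSpace I T hT hM f q hv hU

include hM in
/-- A map of the orbit space, in the charts, is a local lift with the right value. -/
theorem writtenInExtChartAt_eventuallyEq_of_lift {f : OrbitSpace T → OrbitSpace T}
    {q : OrbitSpace T} {σ : U → U}
    (hσ : ContinuousAt σ (Quotient.out q)) (hq : σ (Quotient.out q) = Quotient.out (f q))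
    (h : ∀ᶠ z in 𝓝 (Quotient.out q), f (proj T z) = proj T (σ z)) :
    letI := orbitChartedSpace M T hT
    writtenInExtChartAt I I q f =ᶠ[𝓝[Set.range I] (I ((Quotient.out q : U) : M))] coordRep I σ :=
  (writtenInExtChartAt_eventuallyEq I T hT hM f q).trans
    ((coordRep_eventuallyEq I (localLift_eventuallyEq T hT hσ hq h)).filter_mono
      nhdsWithin_le_nhds)

end Charts

/-! ### Automorphisms of the Hopf surface and their lifts to `ℂ²`. -/

theorem HopfData.differentiable_G (D : HopfData) : Differentiable ℂ D.G := by
  change Differentiable ℂ fun z : ℂ × ℂ => (D.lam * z.1 + D.tau * z.2 ^ D.p, D.mu * z.2)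
  fun_prop

theorem HopfData.differentiable_G_symm (D : HopfData) : Differentiable ℂ D.G.symm := by
  change Differentiable ℂ fun w : ℂ × ℂ =>
    ((w.1 - D.tau * (w.2 / D.mu) ^ D.p) / D.lam, w.2 / D.mu)
  simp only [div_eq_mul_inv]
  fun_prop

theorem HopfData.differentiable_G_zpow (D : HopfData) (n : ℤ) : Differentiable ℂ (D.G ^ n) := by
  have hnat : ∀ S : (ℂ × ℂ) ≃ₜ (ℂ × ℂ), Differentiable ℂ S → ∀ k : ℕ,
      Differentiable ℂ (S ^ k) := by
    intro S hS k
    induction k with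
    | zero => exact differentiable_id
    | succ k ih => rw [pow_succ]; exact ih.comp hS
  rcases n with k | k
  · simpa using hnat D.G D.differentiable_G k
  · rw [zpow_negSucc, ← inv_pow]
    exact hnat D.G⁻¹ D.differentiable_G_symm (k + 1)

theorem HopfData.coe_GW_zpow (D : HopfData) (n : ℤ) (z : W) :
    ((D.GW ^ n) z : ℂ × ℂ) = (D.G ^ n) z := by
  have hnat : ∀ (k : ℕ) (z : W), ((D.GW ^ k) z : ℂ × ℂ) = (D.G ^ k) z := by
    intro k
    induction k with
    | zero => intro z; rfl
    | succ k ih =>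
      intro z
      simp only [pow_succ, Homeomorph.mul_apply]
      rw [ih]
      rfl
  rcases n with k | k
  · exact hnat k z
  · rw [zpow_negSucc, zpow_negSucc]
    apply (D.G ^ (k + 1)).injective
    rw [← hnat, ← Homeomorph.mul_apply, ← Homeomorph.mul_apply, mul_inv_cancel, mul_inv_cancel]
    rfl

theorem zpow_neg_apply_zpow {X : Type*} [TopologicalSpace X] (T : X ≃ₜ X) (n : ℤ) (x : X) :
    (T ^ (-n)) ((T ^ n) x) = x := by
  rw [← Homeomorph.mul_apply, ← zpow_add]
  simp

theorem zpow_apply_zpow_neg {X : Type*} [TopologicalSpace X] (T : X ≃ₜ X) (n : ℤ) (x : X) :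
    (T ^ n) ((T ^ (-n)) x) = x := by
  rw [← Homeomorph.mul_apply, ← zpow_add]
  simp

theorem HopfData.differentiableAt_coordRep_GW_zpow (D : HopfData) (n : ℤ) (z : W) :
    DifferentiableAt ℂ (coordRep 𝓘(ℂ, ℂ × ℂ) (D.GW ^ n)) z := by
  refine (D.differentiable_G_zpow n z).congr_of_eventuallyEq ?_
  filter_upwards [W.isOpen.mem_nhds z.2] with v hv
  exact (coordRep_apply 𝓘(ℂ, ℂ × ℂ) (D.GW ^ n) ⟨v, hv⟩).trans (D.coe_GW_zpow n ⟨v, hv⟩)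

/-- Deck transformations are biholomorphic, so composing a lift with them on either side keeps it
holomorphic. This compares an arbitrary lift with the one picked out by the charts. -/
theorem HopfData.differentiableAt_coordRep_conj (D : HopfData) (m n : ℤ) {g : W → W} (z : W)
    (hg : DifferentiableAt ℂ (coordRep 𝓘(ℂ, ℂ × ℂ) g) ((D.GW ^ n) z)) :
    DifferentiableAt ℂ (coordRep 𝓘(ℂ, ℂ × ℂ) (fun w => (D.GW ^ m) (g ((D.GW ^ n) w)))) z := by
  have h1 := D.differentiableAt_coordRep_GW_zpow n z
  have e1 : coordRep 𝓘(ℂ, ℂ × ℂ) (D.GW ^ n) z = (D.GW ^ n) z := coordRep_apply 𝓘(ℂ, ℂ × ℂ) _ z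
  have h2 : DifferentiableAt ℂ (fun v => coordRep 𝓘(ℂ, ℂ × ℂ) g
      (coordRep 𝓘(ℂ, ℂ × ℂ) (D.GW ^ n) v)) z :=
    DifferentiableAt.comp (g := coordRep 𝓘(ℂ, ℂ × ℂ) g) (z : ℂ × ℂ) (by rwa [e1]) h1
  have e2 : coordRep 𝓘(ℂ, ℂ × ℂ) g (coordRep 𝓘(ℂ, ℂ × ℂ) (D.GW ^ n) z) = g ((D.GW ^ n) z) := by
    rw [e1]
    exact coordRep_apply 𝓘(ℂ, ℂ × ℂ) _ _
  have h3 : DifferentiableAt ℂ (fun v => coordRep 𝓘(ℂ, ℂ × ℂ) (D.GW ^ m) (coordRep 𝓘(ℂ, ℂ × ℂ) g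
      (coordRep 𝓘(ℂ, ℂ × ℂ) (D.GW ^ n) v))) z :=
    DifferentiableAt.comp (g := coordRep 𝓘(ℂ, ℂ × ℂ) (D.GW ^ m)) (z : ℂ × ℂ) (by
      rw [e2]; exact D.differentiableAt_coordRep_GW_zpow m _) h2
  refine h3.congr_of_eventuallyEq ?_
  filter_upwards [W.isOpen.mem_nhds z.2] with v hv
  refine (coordRep_comp 𝓘(ℂ, ℂ × ℂ) (D.GW ^ m) (fun w => g ((D.GW ^ n) w)) hv).trans ?_
  exact congrArg _ (coordRep_comp 𝓘(ℂ, ℂ × ℂ) g (⇑(D.GW ^ n)) hv)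

/-- A self-map of the Hopf surface is holomorphic at a point iff a local lift to `W` is. -/
theorem HopfData.mdifferentiableAt_iff_lift (D : HopfData) {h : HopfSurface D → HopfSurface D}
    {g : W → W} {z : W} (hg : ContinuousAt g z)
    (hp : ∀ᶠ w in 𝓝 z, h (D.projH w) = D.projH (g w)) :
    MDifferentiableAt 𝓘(ℂ, ℂ × ℂ) 𝓘(ℂ, ℂ × ℂ) h (D.projH z) ↔
      DifferentiableAt ℂ (coordRep 𝓘(ℂ, ℂ × ℂ) g) z := by
  -- The charts are based at the representatives `Quotient.out`; the powers `n` and `m` carry `z`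
  -- and `g z` to them, and `σ` is `g` corrected accordingly.
  obtain ⟨n, hn⟩ : ∃ n : ℤ, (D.GW ^ n) z = Quotient.out (D.projH z) :=
    (proj_eq_iff D.GW).1 (proj_out D.GW (D.projH z)).symm
  obtain ⟨m, hm⟩ : ∃ m : ℤ, (D.GW ^ m) (g z) = Quotient.out (h (D.projH z)) := by
    rw [hp.self_of_nhds]
    exact (proj_eq_iff D.GW).1 (proj_out D.GW (D.projH (g z))).symm
  set x : W := Quotient.out (D.projH z) with hx
  have hx' : (D.GW ^ (-n)) x = z := by rw [← hn, zpow_neg_apply_zpow]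
  set σ : W → W := fun w => (D.GW ^ m) (g ((D.GW ^ (-n)) w)) with hσ
  have hσc : ContinuousAt σ x := by
    refine (D.GW ^ m).continuous.continuousAt.comp (ContinuousAt.comp (g := g) ?_
      (D.GW ^ (-n)).continuous.continuousAt)
    rwa [hx']
  have hσx : σ x = Quotient.out (h (D.projH z)) := by rw [hσ]; simp only [hx', hm]
  have hproj : ∀ (k : ℤ) (w : W), proj D.GW ((D.GW ^ k) w) = proj D.GW w := fun k w =>
    ((proj_eq_iff D.GW).2 ⟨k, rfl⟩).symm
  have hσp : ∀ᶠ w in 𝓝 x, h (proj D.GW w) = proj D.GW (σ w) := by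
    have h1 : Filter.Tendsto (D.GW ^ (-n)) (𝓝 x) (𝓝 z) := by
      have := (D.GW ^ (-n)).continuous.tendsto x
      rwa [hx'] at this
    filter_upwards [h1.eventually hp] with w hw
    rw [hσ, hproj, ← hproj (-n) w]
    exact hw
  have hw := writtenInExtChartAt_eventuallyEq_of_lift 𝓘(ℂ, ℂ × ℂ) D.GW D.projH_isLocalHomeomorph
    (fun _ => chartAt_self_eq (H := ℂ × ℂ)) hσc hσx hσp
  have hE := extChartAt_orbitSpace 𝓘(ℂ, ℂ × ℂ) D.GW D.projH_isLocalHomeomorph (fun _ => chartAt_self_eq (H := ℂ × ℂ))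
    (D.projH z)
  have hc : ContinuousAt h (D.projH z) :=
    continuousAt_of_lift D.GW D.projH_isLocalHomeomorph hg hp
  have hiff : MDifferentiableAt 𝓘(ℂ, ℂ × ℂ) 𝓘(ℂ, ℂ × ℂ) h (D.projH z) ↔
      DifferentiableAt ℂ (coordRep 𝓘(ℂ, ℂ × ℂ) σ) x := by
    rw [mdifferentiableAt_iff, and_iff_right hc, ← differentiableWithinAt_univ,
      ← ModelWithCorners.range_eq_univ 𝓘(ℂ, ℂ × ℂ)]
    refine Iff.trans ?_ (Filter.EventuallyEq.differentiableWithinAt_iff_of_mem hw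
      (Set.mem_range_self _))
    exact iff_of_eq (congrArg _ hE)
  rw [hiff]
  constructor
  · intro h1
    have h2 := D.differentiableAt_coordRep_conj (-m) n z (g := σ) (by rwa [hn])
    have h3 : (fun w => (D.GW ^ (-m)) (σ ((D.GW ^ n) w))) = g := by
      funext w
      simp only [hσ, zpow_neg_apply_zpow]
    rwa [h3] at h2
  · intro h1
    exact D.differentiableAt_coordRep_conj m (-n) x (by rwa [hx'])

theorem HopfData.isCoveringMap_projH (D : HopfData) : IsCoveringMap (proj D.GW) :=
  proj_isCoveringMap D.GW (fun z => D.height z.1)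
    (D.continuous_height.comp continuous_subtype_val) fun z => D.height_lt z.2

/-- Two lifts to `W` of the same map differ by a power of `G`. -/
theorem HopfData.exists_zpow_of_proj_eq (D : HopfData) {u v : W → W} (hu : Continuous u)
    (hv : Continuous v) (h : ∀ z, proj D.GW (u z) = proj D.GW (v z)) :
    ∃ n : ℤ, ∀ z, u z = (D.GW ^ n) (v z) := by
  obtain ⟨a⟩ := (inferInstance : Nonempty W)
  -- The power is fixed at one point; connectedness of `W` and uniqueness of lifts spread it
  -- everywhere.
  obtain ⟨n, hn⟩ := (proj_eq_iff D.GW).1 (h a).symm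
  refine ⟨n, congrFun (D.isCoveringMap_projH.eq_of_comp_eq hu
    ((D.GW ^ n).continuous.comp hv) (funext fun z => ?_) a hn.symm)⟩
  exact (h z).trans ((proj_eq_iff D.GW).2 ⟨n, rfl⟩)

/-- Every positive power strictly raises the height, so the deck group is infinite cyclic. -/
theorem HopfData.GW_zpow_eq_one (D : HopfData) {n : ℤ} (h : D.GW ^ n = 1) : n = 0 := by
  obtain ⟨a⟩ := (inferInstance : Nonempty W)
  have key : ∀ (k : ℕ) (z : W), D.height z < D.height ((D.GW ^ (k + 1)) z) := by
    intro k
    induction k with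
    | zero => intro z; rw [zero_add, pow_one]; exact D.height_lt z.2
    | succ k ih =>
      intro z
      rw [pow_succ, Homeomorph.mul_apply]
      exact (D.height_lt z.2).trans (ih (D.GW z))
  have hk : ∀ k : ℕ, D.GW ^ (k + 1) ≠ 1 := fun k hk => by
    have := key k a
    rw [hk] at this
    exact lt_irrefl _ this
  rcases n with (_ | k) | k
  · rfl
  · exact absurd h (hk k)
  · rw [zpow_negSucc, inv_eq_one] at h
    exact absurd h (hk k)

/-- A holomorphic automorphism of the Hopf surface lifts to a homeomorphism of `W`. -/
theorem HopfData.exists_lift_homeomorph (D : HopfData) (h : HopfSurface D ≃ₜ HopfSurface D) :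
    ∃ g : W ≃ₜ W, (∀ z, h (D.projH z) = D.projH (g z)) ∧
      ∀ z, h.symm (D.projH z) = D.projH (g.symm z) := by
  have ha : (((Complex.I, 0) : ℂ × ℂ)) ∈ slitPlaneProd ∩ -slitPlaneProd := by
    simp [slitPlaneProd, Complex.mem_slitPlane_iff]
  let a : W := ⟨(Complex.I, 0), fun h => Complex.I_ne_zero (congrArg Prod.fst h)⟩
  have hproj : Continuous D.projH := continuous_proj D.GW
  obtain ⟨g, hg, -, hgp⟩ := exists_lift D.isCoveringMap_projH (f := fun z => h (D.projH z))
    (h.continuous.comp hproj) a ha _ (proj_out D.GW _)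
  obtain ⟨k, hk, -, hkp⟩ := exists_lift D.isCoveringMap_projH (f := fun z => h.symm (D.projH z))
    (h.symm.continuous.comp hproj) a ha _ (proj_out D.GW _)
  have hgp' : ∀ z, D.projH (g z) = h (D.projH z) := hgp
  have hkp' : ∀ z, D.projH (k z) = h.symm (D.projH z) := hkp
  -- The composites of the lifts of `h` and `h⁻¹` lift the identity, hence are deck transformations;
  -- correcting `k` by one of them inverts `g`.
  obtain ⟨i, hi⟩ := D.exists_zpow_of_proj_eq (hk.comp hg) continuous_id fun z => by
    change D.projH (k (g z)) = D.projH z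
    rw [hkp', hgp', h.symm_apply_apply]
  obtain ⟨j, hj⟩ := D.exists_zpow_of_proj_eq (hg.comp hk) continuous_id fun z => by
    change D.projH (g (k z)) = D.projH z
    rw [hgp', hkp', h.apply_symm_apply]
  have hi' : ∀ z, k (g z) = (D.GW ^ i) z := hi
  have hj' : ∀ z, g (k z) = (D.GW ^ j) z := hj
  have hbij : Function.Bijective g := by
    constructor
    · intro x y hxy
      apply (D.GW ^ i).injective
      rw [← hi', ← hi', hxy]
    · intro y
      refine ⟨k ((D.GW ^ (-j)) y), ?_⟩
      rw [hj', zpow_apply_zpow_neg]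
  let e := Equiv.ofBijective g hbij
  have he : ∀ z, e.symm z = (D.GW ^ (-i)) (k z) := fun z => by
    apply (D.GW ^ i).injective
    rw [zpow_apply_zpow_neg, ← hi']
    exact congrArg k (e.apply_symm_apply z)
  refine ⟨⟨e, hg, ?_⟩, fun z => (hgp' z).symm, fun z => ?_⟩
  · change Continuous e.symm
    rw [funext he]
    exact (D.GW ^ (-i)).continuous.comp hk
  · change _ = D.projH (e.symm z)
    rw [he, ← hkp']
    exact (proj_eq_iff D.GW).2 ⟨-i, rfl⟩

theorem HopfData.coeff_pos (D : HopfData) :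
    0 < (‖D.tau‖ + 1) / (‖D.mu‖ ^ D.p - 1) :=
  div_pos (by positivity) (sub_pos.2 (one_lt_pow₀ D.one_lt_mu D.p_pos.ne'))

theorem HopfData.height_zero (D : HopfData) : D.height 0 = 0 := by
  simp [HopfData.height, D.p_pos.ne']

theorem HopfData.height_pos (D : HopfData) {z : ℂ × ℂ} (hz : z ≠ 0) : 0 < D.height z := by
  have hc := D.coeff_pos
  by_cases h : z.1 = 0
  · have : z.2 ≠ 0 := fun h' => hz (Prod.ext h h')
    unfold HopfData.height
    positivity
  · unfold HopfData.height
    positivity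

/-- `G⁻¹` contracts the height function. -/
theorem HopfData.exists_height_symm_le (D : HopfData) :
    ∃ c : ℝ, 0 ≤ c ∧ c < 1 ∧ ∀ z, D.height (D.G.symm z) ≤ c * D.height z := by
  have hA := D.coeff_pos
  have hl : 0 < ‖D.lam‖ - 1 := sub_pos.2 (D.one_lt_mu.trans_le D.mu_le_lam)
  set A := (‖D.tau‖ + 1) / (‖D.mu‖ ^ D.p - 1) with hAdef
  -- These two bounds make the gain in `height_add_le` at least `ε` times the height, term by term,
  -- so `G` expands height by the factor `1 + ε`.
  obtain ⟨ε, hε, hε1, hε2⟩ : ∃ ε : ℝ, 0 < ε ∧ ε ≤ ‖D.lam‖ - 1 ∧ ε * A ≤ 1 :=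
    ⟨min (‖D.lam‖ - 1) (1 / A), by positivity, min_le_left _ _, by
      rw [← le_div_iff₀ hA]; exact min_le_right _ _⟩
  refine ⟨(1 + ε)⁻¹, by positivity, inv_lt_one_of_one_lt₀ (by linarith), fun z => ?_⟩
  have h1 := D.height_add_le (D.G.symm z)
  rw [D.G.apply_symm_apply] at h1
  set w := D.G.symm z
  have h2 : ε * D.height w ≤ (‖D.lam‖ - 1) * ‖w.1‖ + ‖w.2‖ ^ D.p := by
    have h3 : D.height w = ‖w.1‖ + A * ‖w.2‖ ^ D.p := rfl
    have h4 : 0 ≤ ‖w.2‖ ^ D.p := by positivity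
    rw [h3]
    nlinarith [mul_le_mul_of_nonneg_right hε1 (norm_nonneg w.1),
      mul_le_mul_of_nonneg_right hε2 h4]
  rw [inv_mul_eq_div, le_div_iff₀ (by positivity)]
  linarith

/-- The height dominates each of its two nonnegative terms; a `p`-th root recovers the second
coordinate. -/
theorem HopfData.tendsto_zero_of_height (D : HopfData) {u : ℕ → ℂ × ℂ}
    (h : Filter.Tendsto (fun n => D.height (u n)) Filter.atTop (𝓝 0)) :
    Filter.Tendsto u Filter.atTop (𝓝 0) := by
  have hA := D.coeff_pos
  have h1 : Filter.Tendsto (fun n => (u n).1) Filter.atTop (𝓝 0) := by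
    refine squeeze_zero_norm (fun n => ?_) h
    unfold HopfData.height
    have : 0 ≤ (‖D.tau‖ + 1) / (‖D.mu‖ ^ D.p - 1) * ‖(u n).2‖ ^ D.p := by positivity
    linarith
  have h2 : Filter.Tendsto (fun n => ‖(u n).2‖ ^ D.p) Filter.atTop (𝓝 0) := by
    refine squeeze_zero (fun n => by positivity) (fun n => ?_)
      (by simpa using h.div_const ((‖D.tau‖ + 1) / (‖D.mu‖ ^ D.p - 1)))
    rw [le_div_iff₀ hA]
    unfold HopfData.height
    nlinarith [norm_nonneg (u n).1]
  have h3 : Filter.Tendsto (fun n => (u n).2) Filter.atTop (𝓝 0) := by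
    rw [tendsto_zero_iff_norm_tendsto_zero]
    have hp : (0 : ℝ) < (D.p : ℝ)⁻¹ := inv_pos.2 (Nat.cast_pos.2 D.p_pos)
    have h4 := h2.rpow_const (p := (D.p : ℝ)⁻¹) (.inr hp.le)
    rw [Real.zero_rpow hp.ne'] at h4
    refine h4.congr fun n => ?_
    exact Real.pow_rpow_inv_natCast (norm_nonneg _) D.p_pos.ne'
  exact h1.prodMk_nhds h3

theorem HopfData.tendsto_iterate_symm (D : HopfData) (z : ℂ × ℂ) :
    Filter.Tendsto (fun n => D.G.symm^[n] z) Filter.atTop (𝓝 0) := by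
  obtain ⟨c, hc0, hc1, hc⟩ := D.exists_height_symm_le
  have hn : ∀ n, D.height (D.G.symm^[n] z) ≤ c ^ n * D.height z := by
    intro n
    induction n with
    | zero => simp
    | succ n ih =>
      rw [Function.iterate_succ_apply', pow_succ']
      nlinarith [hc (D.G.symm^[n] z), mul_le_mul_of_nonneg_left ih hc0]
  refine D.tendsto_zero_of_height (squeeze_zero (fun n => ?_) hn ?_)
  · by_cases h : D.G.symm^[n] z = 0
    · rw [h, D.height_zero]
    · exact (D.height_pos h).le
  · simpa using (tendsto_pow_atTop_nhds_zero_of_lt_one hc0 hc1).mul_const (D.height z)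

/-- A continuous map fixing the origin cannot invert the dynamics of `G`. -/
theorem HopfData.not_conj_inv (D : HopfData) {F : ℂ × ℂ → ℂ × ℂ} (hF : Continuous F)
    (hF0 : F 0 = 0) {z : ℂ × ℂ} (hz : F z ≠ 0) (h : ∀ y, F (D.G.symm y) = D.G (F y)) : False := by
  -- Along the backward orbit of `z`, which tends to 0, the images under `F` would have
  -- nondecreasing height, although continuity forces that height to 0.
  have h1 : ∀ n, D.height (F z) ≤ D.height (F (D.G.symm^[n] z)) := by
    intro n
    induction n with
    | zero => exact le_rfl
    | succ n ih =>
      rw [Function.iterate_succ_apply', h]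
      exact ih.trans (D.height_le _)
  have h2 : Filter.Tendsto (fun n => D.height (F (D.G.symm^[n] z))) Filter.atTop
      (𝓝 (D.height (F 0))) :=
    ((D.continuous_height.comp hF).tendsto 0).comp (D.tendsto_iterate_symm z)
  have h3 := ge_of_tendsto' h2 h1
  rw [hF0, D.height_zero] at h3
  exact absurd (D.height_pos hz) (not_lt.2 h3)

/-- A lift to `W` of an automorphism of the Hopf surface conjugates `G` to `G` or to `G⁻¹`. -/
theorem HopfData.conj_lift (D : HopfData) {h : HopfSurface D ≃ₜ HopfSurface D} {g : W ≃ₜ W}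
    (hg : ∀ z, h (D.projH z) = D.projH (g z))
    (hg' : ∀ z, h.symm (D.projH z) = D.projH (g.symm z)) :
    (∀ z, g (D.GW z) = D.GW (g z)) ∨ ∀ z, g (D.GW z) = D.GW.symm (g z) := by
  have hGW : ∀ z, D.projH (D.GW z) = D.projH z := fun z =>
    ((proj_eq_iff D.GW).2 ⟨1, by simp⟩).symm
  obtain ⟨m, hm⟩ := D.exists_zpow_of_proj_eq (u := fun z => g (D.GW z))
    (g.continuous.comp D.GW.continuous) g.continuous fun z => by
      change D.projH (g (D.GW z)) = D.projH (g z)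
      rw [← hg, ← hg, hGW]
  obtain ⟨l, hl⟩ := D.exists_zpow_of_proj_eq (u := fun z => g.symm (D.GW z))
    (g.symm.continuous.comp D.GW.continuous) g.symm.continuous fun z => by
      change D.projH (g.symm (D.GW z)) = D.projH (g.symm z)
      rw [← hg', ← hg', hGW]
  have h1 : g * D.GW * g⁻¹ = D.GW ^ m := by
    ext1 z
    simp only [Homeomorph.mul_apply]
    exact (hm (g⁻¹ z)).trans (congrArg _ (g.apply_symm_apply z))
  have h2 : D.GW = g * D.GW ^ l * g⁻¹ := by
    ext1 z
    simp only [Homeomorph.mul_apply]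
    exact (g.apply_symm_apply (D.GW z)).symm.trans (congrArg g (hl z))
  -- Conjugation by `g` sends the generator to its `m`-th power, and conjugation by `g⁻¹` to its
  -- `l`-th, so `m * l = 1` by infinite order.
  rw [← conj_zpow, h1, ← zpow_mul] at h2
  have h3 : m * l - 1 = 0 := D.GW_zpow_eq_one (by rw [zpow_sub, ← h2]; simp)
  rcases Int.mul_eq_one_iff_eq_one_or_neg_one.1 (sub_eq_zero.1 h3) with ⟨rfl, -⟩ | ⟨rfl, -⟩
  · left
    intro z
    simpa using hm z
  · right
    intro z
    have := hm z
    rwa [zpow_neg_one] at this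

/-- Every automorphism of the Hopf surface lifts to a biholomorphism of `ℂ²` which fixes the
origin and commutes with `G`. -/
theorem HopfData.exists_lift_biholomorphism (D : HopfData) (h : AutH D) :
    ∃ F : (ℂ × ℂ) ≃ (ℂ × ℂ), Differentiable ℂ F ∧ Differentiable ℂ F.symm ∧ F 0 = 0 ∧
      (∀ z, F (D.G z) = D.G (F z)) ∧
      ∀ z : W, ∃ w : W, (w : ℂ × ℂ) = F z ∧ h.1 (D.projH z) = D.projH w := by
  obtain ⟨h, hh, hh'⟩ := h
  obtain ⟨g, hg, hg'⟩ := D.exists_lift_homeomorph h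
  have hext : ∀ (h : HopfSurface D ≃ₜ HopfSurface D) (g : W ≃ₜ W),
      MDifferentiable 𝓘(ℂ, ℂ × ℂ) 𝓘(ℂ, ℂ × ℂ) h → (∀ z, h (D.projH z) = D.projH (g z)) →
      ∃ F : ℂ × ℂ → ℂ × ℂ, Differentiable ℂ F ∧ ∀ z : W, F z = g z := by
    intro h g hh hg
    obtain ⟨F, hF, hFg⟩ := exists_differentiable_extension
      (g := coordRep 𝓘(ℂ, ℂ × ℂ) g) fun z hz =>
        ((D.mdifferentiableAt_iff_lift (z := ⟨z, hz⟩) g.continuous.continuousAt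
          (Filter.Eventually.of_forall hg)).1 (hh _)).differentiableWithinAt
    exact ⟨F, hF, fun z => (hFg z.2).trans (coordRep_apply 𝓘(ℂ, ℂ × ℂ) g z)⟩
  obtain ⟨F, hF, hFg⟩ := hext h g hh hg
  obtain ⟨K, hK, hKg⟩ := hext h.symm g.symm hh' hg'
  have hdense : Dense ((W : Set (ℂ × ℂ))) := dense_compl_singleton 0
  have hFK : ∀ z, F (K z) = z := congrFun (Continuous.ext_on hdense
    (hF.continuous.comp hK.continuous) continuous_id fun z hz => by
      rw [hKg ⟨z, hz⟩, hFg, g.apply_symm_apply])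
  have hKF : ∀ z, K (F z) = z := congrFun (Continuous.ext_on hdense
    (hK.continuous.comp hF.continuous) continuous_id fun z hz => by
      rw [hFg ⟨z, hz⟩, hKg, g.symm_apply_apply])
  -- Otherwise `F 0` lies in `W`, where `K` agrees with `g⁻¹` and takes nonzero values, against `K
  -- (F 0) = 0`.
  have hF0 : F 0 = 0 := by
    by_contra hne
    have h1 := hKg ⟨F 0, hne⟩
    have h2 := (g.symm ⟨F 0, hne⟩).2
    rw [← h1] at h2
    exact h2 (hKF 0)
  refine ⟨⟨F, K, hKF, hFK⟩, hF, hK, hF0, ?_, fun z => ⟨g z, (hFg z).symm, hg z⟩⟩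
  rcases D.conj_lift hg hg' with hc | hc
  · intro z
    change F (D.G z) = D.G (F z)
    by_cases hz : z = 0
    · rw [hz, D.G_zero, hF0, D.G_zero]
    · have h1 : F (D.G z) = g (D.GW ⟨z, hz⟩) := hFg (D.GW ⟨z, hz⟩)
      rw [h1, hc, hFg ⟨z, hz⟩]
      rfl
  · exfalso
    obtain ⟨a⟩ := (inferInstance : Nonempty W)
    refine D.not_conj_inv hF.continuous hF0 (z := a) (by rw [hFg]; exact (g a).2) fun y => ?_
    have key : ∀ x, F x = D.G (F (D.G x)) := by
      intro x
      by_cases hx : x = 0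
      · rw [hx, D.G_zero, hF0, D.G_zero]
      · have h1 : F (D.G x) = g (D.GW ⟨x, hx⟩) := hFg (D.GW ⟨x, hx⟩)
        have h2 : D.G (D.GW.symm (g ⟨x, hx⟩) : ℂ × ℂ) = D.GW (D.GW.symm (g ⟨x, hx⟩)) := rfl
        rw [h1, hc, h2, D.GW.apply_symm_apply, hFg ⟨x, hx⟩]
    rw [key, D.G.apply_symm_apply]

/-! ### From biholomorphisms commuting with `G` to leafwise holomorphic maps of `R`. -/

/-- A homeomorphism commuting with `T` acts on the orbit space of `T`. -/
noncomputable def orbitMap {X : Type*} [TopologicalSpace X] {T Φ : X ≃ₜ X} (h : Commute Φ T) :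
    OrbitSpace T ≃ₜ OrbitSpace T where
  toFun := Quotient.map Φ (by
    rintro x _ ⟨n, rfl⟩
    exact ⟨n, by rw [← Homeomorph.mul_apply, ← Homeomorph.mul_apply, (h.zpow_right n).eq]⟩)
  invFun := Quotient.map Φ.symm (by
    rintro x _ ⟨n, rfl⟩
    refine ⟨n, ?_⟩
    have := (h.inv_left.zpow_right n).eq
    exact (congrFun (congrArg DFunLike.coe this) x).symm)
  left_inv := by
    rintro ⟨x⟩
    exact congrArg (proj T) (Φ.symm_apply_apply x)
  right_inv := by
    rintro ⟨x⟩
    exact congrArg (proj T) (Φ.apply_symm_apply x)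
  continuous_toFun := Continuous.quotient_map' Φ.continuous _
  continuous_invFun := Continuous.quotient_map' Φ.symm.continuous _

theorem Holonomy.contMDiff_zpow (P : Holonomy) (n : ℤ) :
    ContMDiff halfLine halfLine ∞ (P.φ.toHomeomorph ^ n) := by
  have hnat : ∀ (S : ℝ≥0 ≃ₜ ℝ≥0), ContMDiff halfLine halfLine ∞ S →
      ∀ k : ℕ, ContMDiff halfLine halfLine ∞ (S ^ k) := by
    intro S hS k
    induction k with
    | zero => exact contMDiff_id
    | succ k ih => rw [pow_succ]; exact ih.comp hS
  rcases n with k | k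
  · simpa using hnat P.φ.toHomeomorph P.φ.contMDiff k
  · rw [zpow_negSucc, ← inv_pow]
    exact hnat P.φ.toHomeomorph⁻¹ P.φ.symm.contMDiff (k + 1)

theorem Holonomy.contDiffOn_zpow (P : Holonomy) (n : ℤ) :
    ContDiffOn ℝ ∞ (fun t => (((P.φ.toHomeomorph ^ n) (Real.toNNReal t) : ℝ≥0) : ℝ))
      (Set.Ici 0) := by
  have h := (contMDiff_iff.1 (P.contMDiff_zpow n)).2 0 0
  refine h.mono fun t ht => ?_
  rw [Set.mem_inter_iff, extChartAt_target]
  refine ⟨⟨trivial, ⟨⟨t, ht⟩, rfl⟩⟩, ?_⟩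
  rw [Set.mem_preimage, Set.mem_preimage, extChartAt_source]
  exact Set.mem_univ _

theorem reebT_zpow_apply (D : HopfData) (P : Holonomy) (n : ℤ) (u : Rt) :
    ((reebT D P ^ n) u).1 = ((D.G ^ n) u.1.1, (P.φ.toHomeomorph ^ n) u.1.2) := by
  have hnat : ∀ (k : ℕ) (u : Rt),
      ((reebT D P ^ k) u).1 = ((D.G ^ k) u.1.1, (P.φ.toHomeomorph ^ k) u.1.2) := by
    intro k
    induction k with
    | zero => intro u; rfl
    | succ k ih =>
      intro u
      simp only [pow_succ, Homeomorph.mul_apply]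
      rw [ih]
      rfl
  rcases n with k | k
  · exact hnat k u
  · simp only [zpow_negSucc]
    have h1 := hnat k.succ ((reebT D P ^ (k + 1))⁻¹ u)
    rw [← Homeomorph.mul_apply, mul_inv_cancel, Homeomorph.one_apply] at h1
    refine Prod.ext ?_ ?_
    · apply (D.G ^ (k + 1)).injective
      rw [← Homeomorph.mul_apply, mul_inv_cancel, Homeomorph.one_apply]
      exact (congrArg Prod.fst h1).symm
    · apply (P.φ.toHomeomorph ^ (k + 1)).injective
      rw [← Homeomorph.mul_apply, mul_inv_cancel, Homeomorph.one_apply]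
      exact (congrArg Prod.snd h1).symm

theorem chartAt_reebModel (m : (ℂ × ℂ) × ℝ≥0) :
    chartAt (ModelProd (ℂ × ℂ) ℝ≥0) m = OpenPartialHomeomorph.refl ((ℂ × ℂ) × ℝ≥0) := by
  rw [prodChartedSpace_chartAt]
  exact OpenPartialHomeomorph.refl_prod_refl

theorem snd_nonneg_of_mem_range {v : (ℂ × ℂ) × ℝ} (hv : v ∈ Set.range reebModel) : 0 ≤ v.2 := by
  obtain ⟨m, rfl⟩ := hv
  exact m.2.2

theorem mem_range_reebModel {v : (ℂ × ℂ) × ℝ} (hv : 0 ≤ v.2) : v ∈ Set.range reebModel :=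
  ⟨(v.1, ⟨v.2, hv⟩), rfl⟩

/-- The block-diagonal form of the derivative is what preserves leaf directions and makes it
complex-linear along them. -/
theorem hasFDerivWithinAt_prodMap_range {Φ : ℂ × ℂ → ℂ × ℂ} {ψ : ℝ → ℝ} {v : (ℂ × ℂ) × ℝ}
    (hv : 0 ≤ v.2) (hΦ : DifferentiableAt ℂ Φ v.1) (hψ : DifferentiableOn ℝ ψ (Set.Ici 0)) :
    HasFDerivWithinAt (fun w : (ℂ × ℂ) × ℝ => (Φ w.1, ψ w.2))
      (((fderiv ℂ Φ v.1).restrictScalars ℝ).prodMap (fderivWithin ℝ ψ (Set.Ici 0) v.2))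
      (Set.range reebModel) v := by
  have h1 : HasFDerivAt Φ ((fderiv ℂ Φ v.1).restrictScalars ℝ) v.1 :=
    hΦ.hasFDerivAt.restrictScalars ℝ
  have h2 := (hψ v.2 hv).hasFDerivWithinAt
  exact (h1.comp_hasFDerivWithinAt v hasFDerivWithinAt_fst).prodMk
    (h2.comp v hasFDerivWithinAt_snd fun w hw => snd_nonneg_of_mem_range hw)

/-- Near the point representing `q`, a map of `R` which lifts to `F × id` is in the charts
a product. -/
theorem written_reeb_of_lift {D : HopfData} {P : Holonomy} {f : Reeb D P → Reeb D P}
    {F : ℂ × ℂ → ℂ × ℂ} {Φ : Rt → Rt} (hΦc : Continuous Φ)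
    (hΦ : ∀ u, (Φ u).1 = (F u.1.1, u.1.2)) (hf : ∀ u, f (projR D P u) = projR D P (Φ u))
    (q : Reeb D P) :
    ∃ m : ℤ, writtenInExtChartAt reebModel reebModel q f
      =ᶠ[𝓝[Set.range reebModel] (extChartAt reebModel q q)]
      fun v => ((D.G ^ m) (F v.1), (((P.φ.toHomeomorph ^ m) (Real.toNNReal v.2) : ℝ≥0) : ℝ)) := by
  have hE := extChartAt_orbitSpace reebModel (reebT D P) (projR_isLocalHomeomorph D P)
    chartAt_reebModel q
  -- The lift `Φ` need not send the chosen representative of `q` to that of `f q`; the power `m` of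
  -- `T` makes up the difference.
  obtain ⟨m, hm⟩ : ∃ m : ℤ, (reebT D P ^ m) (Φ (Quotient.out q)) = Quotient.out (f q) := by
    refine (proj_eq_iff (reebT D P)).1 ((hf _).symm.trans ?_)
    exact (congrArg f (proj_out (reebT D P) q)).trans (proj_out (reebT D P) (f q)).symm
  refine ⟨m, ?_⟩
  have hw := writtenInExtChartAt_eventuallyEq_of_lift reebModel (reebT D P)
    (projR_isLocalHomeomorph D P) chartAt_reebModel (f := f) (q := q)
    (σ := fun u => (reebT D P ^ m) (Φ u))
    ((reebT D P ^ m).continuous.comp hΦc).continuousAt hm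
    (Filter.Eventually.of_forall fun u => (hf u).trans ((proj_eq_iff (reebT D P)).2 ⟨m, rfl⟩))
  refine (Filter.EventuallyEq.trans (hE ▸ hw) ?_)
  have hU := eventually_symm_mem reebModel (U := Rt) (Quotient.out q)
  rw [← hE] at hU
  filter_upwards [mem_nhdsWithin_of_mem_nhds hU, self_mem_nhdsWithin] with v hv hv2
  obtain ⟨a, rfl⟩ := hv2
  rw [reebModel.left_inv] at hv
  refine (coordRep_apply reebModel _ ⟨a, hv⟩).trans ?_
  have h1 : ((reebT D P ^ m) (Φ ⟨a, hv⟩)).1 =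
      ((D.G ^ m) (F a.1), (P.φ.toHomeomorph ^ m) a.2) := by
    rw [reebT_zpow_apply, hΦ]
  refine (congrArg reebModel h1).trans ?_
  have h2 : Real.toNNReal ((reebModel a).2) = a.2 := Real.toNNReal_coe
  simp only [h2]
  rfl

theorem isLeafwiseHolomorphic_of_lift {D : HopfData} {P : Holonomy} {f : Reeb D P → Reeb D P}
    {F : ℂ × ℂ → ℂ × ℂ} (hF : Differentiable ℂ F) {Φ : Rt → Rt} (hΦc : Continuous Φ)
    (hΦ : ∀ u, (Φ u).1 = (F u.1.1, u.1.2)) (hf : ∀ u, f (projR D P u) = projR D P (Φ u)) :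
    IsLeafwiseHolomorphic f := by
  have hcont : Continuous f := (proj_isQuotientMap (reebT D P)).continuous_iff.2
    (((continuous_proj (reebT D P)).comp hΦc).congr fun u => (hf u).symm)
  have hmem : ∀ q : Reeb D P, extChartAt reebModel q q ∈ Set.range reebModel := fun q =>
    extChartAt_target_subset_range q (mem_extChartAt_target q)
  have hsmooth : ContMDiff reebModel reebModel ∞ f := by
    intro q
    refine contMDiffAt_iff.2 ⟨hcont.continuousAt, ?_⟩
    obtain ⟨m, hm⟩ := written_reeb_of_lift hΦc hΦ hf q
    refine ContDiffWithinAt.congr_of_eventuallyEq ?_ hm (hm.self_of_nhdsWithin (hmem q))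
    have h1 : ContDiff ℝ ∞ fun z => (D.G ^ m) (F z) :=
      (((D.differentiable_G_zpow m).comp hF).contDiff_complex).restrict_scalars ℝ
    exact (h1.contDiffWithinAt.comp _ contDiffWithinAt_fst (Set.mapsTo_univ _ _)).prodMk
      ((P.contDiffOn_zpow m _ (snd_nonneg_of_mem_range (hmem q))).comp _ contDiffWithinAt_snd
        fun w hw => snd_nonneg_of_mem_range hw)
  refine ⟨hsmooth, fun x => ⟨x, ?_⟩, fun q => ?_⟩
  · rintro _ ⟨u, hu, rfl⟩
    refine ⟨Φ u, ?_, (hf u).symm⟩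
    change (Φ u).1.2 = x
    rw [hΦ]
    exact hu
  · obtain ⟨m, hm⟩ := written_reeb_of_lift hΦc hΦ hf q
    have h1 := hasFDerivWithinAt_prodMap_range (snd_nonneg_of_mem_range (hmem q))
      (((D.differentiable_G_zpow m).comp hF) _)
      ((P.contDiffOn_zpow m).differentiableOn (by simp))
    have h2 := (h1.congr_of_eventuallyEq hm (hm.self_of_nhdsWithin (hmem q))).fderivWithin
      (reebModel.uniqueDiffOn _ (hmem q))
    refine ⟨fderiv ℂ ((D.G ^ m) ∘ F) (extChartAt reebModel q q).1, fun v => ?_⟩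
    rw [(hsmooth.mdifferentiable (by simp) q).mfderiv, h2]
    exact Prod.ext rfl (ContinuousLinearMap.map_zero _)

/-! ### The boundary leaf and the restriction homomorphism. -/

variable {D : HopfData} {P : Holonomy}

theorem Holonomy.zpow_apply_zero (P : Holonomy) (n : ℤ) : (P.φ.toHomeomorph ^ n) 0 = 0 := by
  have hnat : ∀ k : ℕ, (P.φ.toHomeomorph ^ k) 0 = 0 := by
    intro k
    induction k with
    | zero => rfl
    | succ k ih =>
      rw [pow_succ, Homeomorph.mul_apply]
      exact (congrArg _ P.apply_zero).trans ih
  rcases n with k | k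
  · exact hnat k
  · apply (P.φ.toHomeomorph ^ (k + 1)).injective
    rw [zpow_negSucc, ← Homeomorph.mul_apply, mul_inv_cancel, hnat]
    rfl

theorem projR_mem_leaf_iff {u : Rt} {x : ℝ≥0} :
    projR D P u ∈ leaf D P x ↔ ∃ n : ℤ, (P.φ.toHomeomorph ^ n) u.1.2 = x := by
  constructor
  · rintro ⟨v, hv, hvu⟩
    obtain ⟨n, hn⟩ := (proj_eq_iff (reebT D P)).1 hvu.symm
    refine ⟨n, ?_⟩
    have h := reebT_zpow_apply D P n u
    rw [hn] at h
    rw [← show v.1.2 = x from hv, h]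
  · rintro ⟨n, hn⟩
    refine ⟨(reebT D P ^ n) u, ?_, ((proj_eq_iff (reebT D P)).2 ⟨n, rfl⟩).symm⟩
    change ((reebT D P ^ n) u).1.2 = x
    rw [reebT_zpow_apply, hn]

theorem projR_mem_leaf_zero_iff {u : Rt} : projR D P u ∈ leaf D P 0 ↔ u.1.2 = 0 := by
  rw [projR_mem_leaf_iff]
  constructor
  · rintro ⟨n, hn⟩
    exact (P.φ.toHomeomorph ^ n).injective (hn.trans (P.zpow_apply_zero n).symm)
  · intro h
    exact ⟨0, h⟩

theorem isClosed_leaf_zero : IsClosed (leaf D P 0) := by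
  refine (proj_isQuotientMap (reebT D P)).isClosed_preimage.1 ?_
  have h : proj (reebT D P) ⁻¹' leaf D P 0 = {u : Rt | u.1.2 = 0} :=
    Set.ext fun u => projR_mem_leaf_zero_iff
  rw [h]
  exact isClosed_eq (continuous_snd.comp continuous_subtype_val) continuous_const

/-- Backward iterates decrease, so they converge to a fixed point of `φ`, and 0 is the only one. -/
theorem Holonomy.tendsto_iterate_symm (P : Holonomy) (x : ℝ≥0) :
    Filter.Tendsto (fun n => P.φ.symm^[n] x) Filter.atTop (𝓝 0) := by
  have hle : ∀ y, P.φ.symm y ≤ y := by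
    intro y
    rcases eq_or_ne (P.φ.symm y) 0 with h | h
    · rw [h]; exact zero_le
    · have := P.lt_apply _ (pos_iff_ne_zero.2 h)
      rw [P.φ.apply_symm_apply] at this
      exact this.le
  have hanti : Antitone fun n => P.φ.symm^[n] x := antitone_nat_of_succ_le fun n => by
    rw [Function.iterate_succ_apply']
    exact hle _
  have hlim := tendsto_atTop_ciInf hanti (OrderBot.bddBelow _)
  set L := ⨅ n, P.φ.symm^[n] x
  have hfix : P.φ.symm L = L :=
    isFixedPt_of_tendsto_iterate hlim P.φ.symm.continuous.continuousAt
  have hL : L = 0 := by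
    by_contra hne
    have h1 := P.lt_apply L (pos_iff_ne_zero.2 hne)
    have h2 : P.φ L = L := by
      conv_lhs => rw [← hfix]
      exact P.φ.apply_symm_apply L
    exact h1.ne' h2
  rwa [hL] at hlim

theorem leaf_closed_iff {x : ℝ≥0} : IsClosed (leaf D P x) ↔ x = 0 := by
  refine ⟨fun hcl => ?_, fun h => h ▸ isClosed_leaf_zero⟩
  have hmem : ∀ t : ℝ≥0, (((1, 0), t) : (ℂ × ℂ) × ℝ≥0) ∈ Rt := fun t h =>
    one_ne_zero (congrArg (fun q => q.1.1) h)
  -- A leaf of `R` contains the image of all of `ℂ²` at each height of the orbit of `x`, so the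
  -- `ℂ²`-coordinate may stay fixed, away from the origin, while the height tends to 0.
  let u : ℝ≥0 → Rt := fun t => ⟨((1, 0), t), hmem t⟩
  have hu : Continuous u := Continuous.subtype_mk (by fun_prop) _
  have hlim : Filter.Tendsto (fun n => projR D P (u (P.φ.symm^[n] x))) Filter.atTop
      (𝓝 (projR D P (u 0))) :=
    (((continuous_proj (reebT D P)).comp hu).tendsto 0).comp (P.tendsto_iterate_symm x)
  have hn : ∀ n : ℕ, projR D P (u (P.φ.symm^[n] x)) ∈ leaf D P x := by
    intro n
    rw [projR_mem_leaf_iff]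
    refine ⟨n, ?_⟩
    change (P.φ.toHomeomorph ^ (n : ℤ)) (P.φ.symm^[n] x) = x
    induction n with
    | zero => rfl
    | succ n ih =>
      rw [Function.iterate_succ_apply', zpow_natCast, pow_succ, Homeomorph.mul_apply]
      refine Eq.trans (congrArg _ ?_) ih
      exact P.φ.apply_symm_apply _
  obtain ⟨n, h0⟩ := projR_mem_leaf_iff.1 (hcl.mem_of_tendsto hlim (Filter.Eventually.of_forall hn))
  exact h0.symm.trans (P.zpow_apply_zero n)

/-- An automorphism of the Reeb component preserves the boundary leaf, which is the only closed
leaf. -/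
theorem mapsTo_leaf_zero {f : Reeb D P ≃ₜ Reeb D P} (hf : IsLeafwiseHolomorphic f)
    (hf' : IsLeafwiseHolomorphic f.symm) : Set.MapsTo f (leaf D P 0) (leaf D P 0) := by
  obtain ⟨y, hy⟩ := hf.2.1 0
  obtain ⟨w, hw⟩ := hf'.2.1 y
  obtain ⟨a⟩ := (inferInstance : Nonempty W)
  have ha : projR D P ⟨(a, 0), zero_height_mem a⟩ ∈ leaf D P 0 := ⟨_, rfl, rfl⟩
  have hw0 : w = 0 := by
    have h1 := hw (hy ha)
    rw [f.symm_apply_apply] at h1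
    obtain ⟨n, hn⟩ := projR_mem_leaf_iff.1 h1
    exact hn.symm.trans (P.zpow_apply_zero n)
  subst hw0
  -- The inverse map sends the target leaf back into `leaf D P 0`, so the image is a whole leaf; it
  -- is closed, which forces `y = 0`.
  have himage : f '' leaf D P 0 = leaf D P y :=
    Set.Subset.antisymm hy.image_subset fun b hb => ⟨_, hw hb, f.apply_symm_apply b⟩
  have hclosed : IsClosed (leaf D P y) := himage ▸ f.isClosedMap _ isClosed_leaf_zero
  rwa [leaf_closed_iff.1 hclosed] at hy

theorem boundaryInclusion_projH (z : W) :
    boundaryInclusion D P (D.projH z) = projR D P ⟨(z, 0), zero_height_mem z⟩ := rfl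

theorem boundaryInclusion_mem (q : HopfSurface D) : boundaryInclusion D P q ∈ leaf D P 0 := by
  obtain ⟨z, rfl⟩ := (proj_isQuotientMap D.GW).surjective q
  exact ⟨_, rfl, (boundaryInclusion_projH z).symm⟩

theorem exists_boundaryInclusion_eq {b : Reeb D P} (hb : b ∈ leaf D P 0) :
    ∃ q, boundaryInclusion D P q = b := by
  obtain ⟨⟨⟨z, x⟩, hu⟩, rfl, rfl⟩ := hb
  exact ⟨D.projH ⟨z, fun h => hu (Prod.ext h rfl)⟩, rfl⟩

theorem continuous_zero_section :
    Continuous fun z : W => (⟨(z, 0), zero_height_mem z⟩ : Rt) :=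
  Continuous.subtype_mk (by fun_prop) _

theorem isClosedEmbedding_boundaryInclusion :
    Topology.IsClosedEmbedding (boundaryInclusion D P) := by
  refine .of_continuous_injective_isClosedMap ?_ (boundaryInclusion_injective D P) fun C hC => ?_
  · exact (proj_isQuotientMap D.GW).continuous_iff.2
      ((continuous_proj (reebT D P)).comp continuous_zero_section)
  · have hq : Topology.IsQuotientMap (projR D P) := proj_isQuotientMap (reebT D P)
    rw [← hq.isClosed_preimage, ← isOpen_compl_iff]
    have hO : IsOpen (Subtype.val '' (D.projH ⁻¹' Cᶜ) : Set (ℂ × ℂ)) :=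
      W.isOpen.isOpenMap_subtype_val _ (hC.isOpen_compl.preimage (continuous_proj D.GW))
    -- Any point at positive height is off the boundary leaf, so the condition on the
    -- `ℂ²`-coordinate matters only at height 0; this displays the complement as a union of two open
    -- sets.
    have h : (projR D P ⁻¹' (boundaryInclusion D P '' C))ᶜ =
        {u : Rt | u.1.2 ≠ 0} ∪ {u : Rt | u.1.1 ∈ Subtype.val '' (D.projH ⁻¹' Cᶜ)} := by
      ext u
      by_cases hu : u.1.2 = 0
      · obtain ⟨⟨z, x⟩, hzx⟩ := u
        obtain rfl : x = 0 := hu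
        let w : W := ⟨z, fun h => hzx (Prod.ext h rfl)⟩
        have h1 : projR D P ⟨(z, 0), hzx⟩ = boundaryInclusion D P (D.projH w) := rfl
        rw [Set.mem_compl_iff, Set.mem_preimage, h1,
          (boundaryInclusion_injective D P).mem_set_image]
        constructor
        · intro h2
          exact .inr ⟨w, h2, rfl⟩
        · rintro (h2 | ⟨w', h2, h3⟩)
          · exact absurd rfl h2
          · rwa [show w' = w from Subtype.ext h3] at h2
      · refine iff_of_true ?_ (.inl hu)
        rintro ⟨q, -, hq⟩
        exact hu (projR_mem_leaf_zero_iff.1 (hq ▸ boundaryInclusion_mem q))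
    rw [h]
    exact (isOpen_ne_fun (continuous_snd.comp continuous_subtype_val) continuous_const).union
      (hO.preimage (continuous_fst.comp continuous_subtype_val))

/-- The restriction of a leafwise holomorphic map to the boundary leaf is holomorphic. -/
theorem mdifferentiable_of_boundaryInclusion {f : Reeb D P → Reeb D P}
    (hf : IsLeafwiseHolomorphic f) {r : HopfSurface D → HopfSurface D}
    (hr : ∀ q, boundaryInclusion D P (r q) = f (boundaryInclusion D P q)) :
    MDifferentiable 𝓘(ℂ, ℂ × ℂ) 𝓘(ℂ, ℂ × ℂ) r := by
  intro q
  set b := boundaryInclusion D P q with hb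
  have hE : extChartAt reebModel b b = reebModel ((Quotient.out b : Rt) : (ℂ × ℂ) × ℝ≥0) :=
    extChartAt_orbitSpace reebModel (reebT D P) (projR_isLocalHomeomorph D P) chartAt_reebModel b
  have hfc : ContinuousAt f b := hf.1.continuous.continuousAt
  have hsc : ContinuousAt (localLift (reebT D P) (projR_isLocalHomeomorph D P) f b)
      (Quotient.out b) := continuousAt_localLift (reebT D P) (projR_isLocalHomeomorph D P) hfc
  have hsp := eventually_proj_localLift (reebT D P) (projR_isLocalHomeomorph D P) hfc
  have hwr := fun {v : (ℂ × ℂ) × ℝ} => writtenInExtChartAt_orbitSpace reebModel (reebT D P)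
    (projR_isLocalHomeomorph D P) chartAt_reebModel f b (v := v)
  have hsx := localLift_out (reebT D P) (projR_isLocalHomeomorph D P) f b
  set s : Rt → Rt := localLift (reebT D P) (projR_isLocalHomeomorph D P) f b
  have hxb : projR D P (Quotient.out b) = b := proj_out (reebT D P) b
  have hyb : projR D P (s (Quotient.out b)) = f b := by
    rw [hsx]; exact proj_out (reebT D P) (f b)
  set x : Rt := Quotient.out b
  have hx0 : x.1.2 = 0 := projR_mem_leaf_zero_iff.1 (by rw [hxb]; exact boundaryInclusion_mem q)
  have hy0 : (s x).1.2 = 0 :=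
    projR_mem_leaf_zero_iff.1 (by rw [hyb, ← hr]; exact boundaryInclusion_mem (r q))
  let z : W := ⟨x.1.1, fun h => x.2 (Prod.ext h hx0)⟩
  have hxz : (⟨(z, 0), zero_height_mem z⟩ : Rt) = x := Subtype.ext (Prod.ext rfl hx0.symm)
  have hzq : D.projH z = q := boundaryInclusion_injective D P (by
    rw [boundaryInclusion_projH, hxz, hxb])
  have hyW : (s x).1.1 ≠ 0 := fun h => (s x).2 (Prod.ext h hy0)
  classical
  -- The local lift of `f` along height 0 is a local lift of `r`; the default `z` is not used near
  -- `z`.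
  let g : W → W := fun a => if h : (s ⟨(a, 0), zero_height_mem a⟩).1.1 ≠ 0 then
    ⟨(s ⟨(a, 0), zero_height_mem a⟩).1.1, h⟩ else z
  have hι : ContinuousAt (fun a : W => s ⟨(a, 0), zero_height_mem a⟩) z := by
    refine ContinuousAt.comp (g := s) ?_ continuous_zero_section.continuousAt
    rwa [hxz]
  have hι' : ContinuousAt (fun a : W => (s ⟨(a, 0), zero_height_mem a⟩).1.1) z :=
    (continuous_fst.comp continuous_subtype_val).continuousAt.comp hι
  have hne : ∀ᶠ a : W in 𝓝 z, (s ⟨(a, 0), zero_height_mem a⟩).1.1 ≠ 0 := by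
    refine hι'.eventually (isOpen_ne.mem_nhds ?_)
    change (s ⟨(z, 0), zero_height_mem z⟩).1.1 ≠ 0
    rwa [hxz]
  have hg : ∀ᶠ a : W in 𝓝 z, (g a : ℂ × ℂ) = (s ⟨(a, 0), zero_height_mem a⟩).1.1 := by
    filter_upwards [hne] with a ha
    simp only [g, dif_pos ha]
  have hgc : ContinuousAt g z := by
    rw [Topology.IsInducing.subtypeVal.continuousAt_iff]
    exact hι'.congr (hg.mono fun a ha => ha.symm)
  have hgp : ∀ᶠ a in 𝓝 z, r (D.projH a) = D.projH (g a) := by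
    have h1 : Filter.Tendsto (fun a : W => (⟨(a, 0), zero_height_mem a⟩ : Rt)) (𝓝 z) (𝓝 x) := by
      have := continuous_zero_section.tendsto z
      rwa [hxz] at this
    filter_upwards [hg, h1.eventually hsp] with a ha hpa
    apply boundaryInclusion_injective D P
    have h2 : boundaryInclusion D P (r (D.projH a)) =
        projR D P (s ⟨(a, 0), zero_height_mem a⟩) := by
      rw [hr, boundaryInclusion_projH]
      exact hpa.symm
    have h3 : (s ⟨(a, 0), zero_height_mem a⟩).1.2 = 0 :=
      projR_mem_leaf_zero_iff.1 (h2 ▸ boundaryInclusion_mem _)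
    rw [h2, boundaryInclusion_projH]
    congr 1
    exact Subtype.ext (Prod.ext ha.symm h3)
  rw [← hzq, D.mdifferentiableAt_iff_lift hgc hgp]
  obtain ⟨A, hA⟩ := hf.2.2 b
  have hmd : MDifferentiableAt reebModel reebModel f b := hf.1.mdifferentiableAt (by simp)
  have hD : HasFDerivWithinAt (writtenInExtChartAt reebModel reebModel b f)
      (mfderiv reebModel reebModel f b : (ℂ × ℂ) × ℝ →L[ℝ] (ℂ × ℂ) × ℝ) (Set.range reebModel)
      ((z : ℂ × ℂ), (0 : ℝ)) := by
    have h1 := hmd.hasMFDerivAt.2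
    have h2 : extChartAt reebModel b b = ((z : ℂ × ℂ), (0 : ℝ)) := by
      rw [hE, ← hxz]
      rfl
    rwa [h2] at h1
  have hinl : HasFDerivAt (fun v : ℂ × ℂ => (v, (0 : ℝ))) (ContinuousLinearMap.inl ℝ (ℂ × ℂ) ℝ)
      (z : ℂ × ℂ) := (ContinuousLinearMap.inl ℝ (ℂ × ℂ) ℝ).hasFDerivAt
  -- The slice at height 0 lies entirely in the range of the model, so the one-sided derivative
  -- restricts to a full real derivative on `ℂ²`. It equals the complex-linear `A`, which gives
  -- complex differentiability.
  have hcomp := (hasFDerivAt_fst (𝕜 := ℝ)).comp (z : ℂ × ℂ)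
    (hD.comp_hasFDerivAt (z : ℂ × ℂ) hinl
      (Filter.Eventually.of_forall fun v => mem_range_reebModel le_rfl))
  refine (hasFDerivAt_of_restrictScalars ℝ (f' := A) (hcomp.congr_of_eventuallyEq ?_)
    ?_).differentiableAt
  · obtain ⟨O, hO, hzO⟩ := (mem_nhds_subtype (W : Set (ℂ × ℂ)) z _).1 hg
    filter_upwards [hO, W.isOpen.mem_nhds z.2] with v hvO hvW
    have h1 : (g ⟨v, hvW⟩ : ℂ × ℂ) = (s ⟨(v, 0), zero_height_mem ⟨v, hvW⟩⟩).1.1 :=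
      hzO (show (⟨v, hvW⟩ : W) ∈ _ from hvO)
    have h2 : coordRep reebModel s (v, (0 : ℝ)) =
        reebModel (s ⟨(v, 0), zero_height_mem ⟨v, hvW⟩⟩).1 :=
      coordRep_apply reebModel s ⟨(v, 0), zero_height_mem ⟨v, hvW⟩⟩
    have h3 : reebModel.symm (v, (0 : ℝ)) ∈ Rt := by
      have h4 : reebModel.symm (reebModel (v, 0)) = (v, 0) := reebModel.left_inv _
      exact h4.symm ▸ zero_height_mem ⟨v, hvW⟩
    refine (coordRep_apply 𝓘(ℂ, ℂ × ℂ) g ⟨v, hvW⟩).trans (h1.trans ?_)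
    have h5 := (hwr (mem_range_reebModel (v := (v, (0 : ℝ))) le_rfl) h3).trans h2
    exact (congrArg Prod.fst h5).symm
  · exact ContinuousLinearMap.ext fun v => (congrArg Prod.fst (hA v)).symm

/-- Both `f` and `f⁻¹` preserve the boundary leaf, and the closed embedding of `H` transfers
continuity and the inverse relations. -/
theorem exists_restriction {f : Reeb D P ≃ₜ Reeb D P} (hf : f ∈ AutR D P) :
    ∃ r : AutH D, ∀ q, boundaryInclusion D P (r.1 q) = f (boundaryInclusion D P q) := by
  have h1 := mapsTo_leaf_zero hf.1 hf.2
  have h2 := mapsTo_leaf_zero (f := f.symm) hf.2 hf.1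
  choose r hr using fun q => exists_boundaryInclusion_eq (h1 (boundaryInclusion_mem q))
  choose k hk using fun q => exists_boundaryInclusion_eq (h2 (boundaryInclusion_mem q))
  have hb := isClosedEmbedding_boundaryInclusion (D := D) (P := P)
  have hrc : Continuous r := hb.isInducing.continuous_iff.2
    ((f.continuous.comp hb.continuous).congr fun q => (hr q).symm)
  have hkc : Continuous k := hb.isInducing.continuous_iff.2
    ((f.symm.continuous.comp hb.continuous).congr fun q => (hk q).symm)
  refine ⟨⟨⟨⟨r, k, fun q => hb.injective ?_, fun q => hb.injective ?_⟩, hrc, hkc⟩,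
    mdifferentiable_of_boundaryInclusion hf.1 hr, mdifferentiable_of_boundaryInclusion hf.2 hk⟩, hr⟩
  · rw [hk, hr, f.symm_apply_apply]
  · rw [hr, hk, f.apply_symm_apply]

/-- The restriction homomorphism to the boundary leaf. -/
noncomputable def restrictBoundary (D : HopfData) (P : Holonomy) : AutR D P →* AutH D where
  toFun f := (exists_restriction f.2).choose
  map_one' := Subtype.ext (Homeomorph.ext fun q => boundaryInclusion_injective D P
    ((exists_restriction (1 : AutR D P).2).choose_spec q))
  map_mul' f g := Subtype.ext (Homeomorph.ext fun q => boundaryInclusion_injective D P (by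
    rw [(exists_restriction (f * g).2).choose_spec q]
    change f.1 (g.1 _) = boundaryInclusion D P ((exists_restriction f.2).choose.1
      ((exists_restriction g.2).choose.1 q))
    rw [(exists_restriction f.2).choose_spec, (exists_restriction g.2).choose_spec]))

theorem boundaryInclusion_restrictBoundary (f : AutR D P) (q : HopfSurface D) :
    boundaryInclusion D P ((restrictBoundary D P f).1 q) = f.1 (boundaryInclusion D P q) :=
  (exists_restriction f.2).choose_spec q

/-! ### Realising automorphisms of `H` on `R`. -/

/-- A biholomorphism of `ℂ²` commuting with `G` acts on the Reeb component. -/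
theorem exists_autR_of_commute (D : HopfData) (P : Holonomy) (F : (ℂ × ℂ) ≃ (ℂ × ℂ))
    (hF : Differentiable ℂ F) (hF' : Differentiable ℂ F.symm) (hF0 : F 0 = 0)
    (hG : ∀ z, F (D.G z) = D.G (F z)) :
    ∃ f : AutR D P, ∀ u : Rt, ∃ v : Rt, v.1 = (F u.1.1, u.1.2) ∧
      f.1 (projR D P u) = projR D P v := by
  let Fh : (ℂ × ℂ) ≃ₜ (ℂ × ℂ) := ⟨F, hF.continuous, hF'.continuous⟩
  have h0 : (Fh.prodCongr (Homeomorph.refl ℝ≥0)) 0 = 0 := Prod.ext hF0 rfl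
  let Φ : Rt ≃ₜ Rt := (Fh.prodCongr (Homeomorph.refl ℝ≥0)).subtype fun u => by
    change u ≠ 0 ↔ _ ≠ 0
    rw [not_iff_not]
    exact ⟨fun h => h ▸ h0, fun h => (Fh.prodCongr _).injective (h.trans h0.symm)⟩
  have hcomm : Commute Φ (reebT D P) :=
    Homeomorph.ext fun u => Subtype.ext (Prod.ext (hG u.1.1) rfl)
  refine ⟨⟨orbitMap hcomm, isLeafwiseHolomorphic_of_lift hF Φ.continuous (fun u => rfl)
    (fun u => rfl), isLeafwiseHolomorphic_of_lift hF' Φ.symm.continuous (fun u => rfl)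
    (fun u => rfl)⟩, fun u => ⟨Φ u, rfl, rfl⟩⟩

end LCReeb

theorem proposition3p3 (D : LCReeb.HopfData) (P : LCReeb.Holonomy) :
    ∃ rH : LCReeb.AutR D P →* LCReeb.AutH D,
      (∀ (f : LCReeb.AutR D P) (q : LCReeb.HopfSurface D),
        LCReeb.boundaryInclusion D P ((rH f).1 q) = f.1 (LCReeb.boundaryInclusion D P q)) ∧
      Function.Surjective rH ∧
      ∀ h : LCReeb.AutH D, ∃ F : (ℂ × ℂ) ≃ (ℂ × ℂ),
        Differentiable ℂ F ∧ Differentiable ℂ F.symm ∧ F 0 = 0 ∧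
        (∀ z : ℂ × ℂ, F (D.G z) = D.G (F z)) ∧
        (∀ z : LCReeb.W, ∃ w : LCReeb.W, (w : ℂ × ℂ) = F z ∧
          h.1 (D.projH z) = D.projH w) ∧
        ∃ f : LCReeb.AutR D P, rH f = h ∧
          ∀ u : LCReeb.Rt, ∃ v : LCReeb.Rt, v.1 = (F u.1.1, u.1.2) ∧
            f.1 (LCReeb.projR D P u) = LCReeb.projR D P v := by
  have main : ∀ h : LCReeb.AutH D, ∃ F : (ℂ × ℂ) ≃ (ℂ × ℂ),
        Differentiable ℂ F ∧ Differentiable ℂ F.symm ∧ F 0 = 0 ∧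
        (∀ z : ℂ × ℂ, F (D.G z) = D.G (F z)) ∧
        (∀ z : LCReeb.W, ∃ w : LCReeb.W, (w : ℂ × ℂ) = F z ∧
          h.1 (D.projH z) = D.projH w) ∧
        ∃ f : LCReeb.AutR D P, LCReeb.restrictBoundary D P f = h ∧
          ∀ u : LCReeb.Rt, ∃ v : LCReeb.Rt, v.1 = (F u.1.1, u.1.2) ∧
            f.1 (LCReeb.projR D P u) = LCReeb.projR D P v := by
    intro h
    obtain ⟨F, hF, hF', hF0, hG, hl⟩ := D.exists_lift_biholomorphism h
    obtain ⟨f, hf⟩ := LCReeb.exists_autR_of_commute D P F hF hF' hF0 hG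
    refine ⟨F, hF, hF', hF0, hG, hl, f, ?_, hf⟩
    -- The restriction of `f` and `h` are compared inside `R`: both send the class of `(z, 0)` to
    -- that of `(F z, 0)`.
    refine Subtype.ext (Homeomorph.ext fun q => LCReeb.boundaryInclusion_injective D P ?_)
    obtain ⟨z, rfl⟩ : ∃ z, D.projH z = q := (LCReeb.proj_isQuotientMap D.GW).surjective q
    rw [LCReeb.boundaryInclusion_restrictBoundary]
    obtain ⟨w, hw, hhw⟩ := hl z
    obtain ⟨v, hv, hfv⟩ := hf ⟨(z, 0), LCReeb.zero_height_mem z⟩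
    refine hfv.trans ?_
    have hvw : v = ⟨(w, 0), LCReeb.zero_height_mem w⟩ :=
      Subtype.ext (hv.trans (Prod.ext hw.symm rfl))
    rw [hvw]
    exact (congrArg (LCReeb.boundaryInclusion D P) hhw).symm
  refine ⟨LCReeb.restrictBoundary D P, LCReeb.boundaryInclusion_restrictBoundary, fun h => ?_, main⟩
  obtain ⟨F, -, -, -, -, -, f, hf, -⟩ := main h
  exact ⟨f, hf⟩
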